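/- Let $q$ be a prime power and let $V$ be a unitary space of finite dimension $n\ge 2$ over $\mathbb{K}=\mathrm{GF}(q^2)$, that is, a vector space with a non-degenerate Hermitian form $\Psi$ with respect to the automorphism of order $2$ of $\mathbb{K}$. Let $\mathcal{F}(V)$ be the frame complex of $V$: the simplicial complex whose vertices are the $1$-dimensional non-degenerate subspaces of $V$ and whose simplices (the partial frames) are the finite sets of pairwise orthogonal such subspaces. Let $\widehat{\mathcal{F}}(V)$ be the reduced frame poset, consisting of all partial frames of size different from $0$ and $n-1$, ordered by inclusion. Let $\Bbbk$ be a field of characteristic $0$. If $n<q+1$, then $$\tilde H_i(\mathcal{F}(V);\Bbbk)=0\qquad\text{for every } 0\le i\le n-3,$$ and $\widehat{\mathcal{F}}(V)$ is $\Bbbk$-homologically Cohen–Macaulay. The latter means: if $\hat P$ is obtained from the poset $P=\widehat{\mathcal{F}}(V)$ by adjoining a new least element $\hat 0$ and a new greatest element $\hat 1$, then for all $x<y$ in $\hat P$ the order complex $\Delta(x,y)$ of the open interval $(x,y)$ satisfies $\tilde H_i(\Delta(x,y);\Bbbk)=0$ for all $i<\dim\Delta(x,y)$ (where the complex without vertices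 has dimension $-1$). -/

import Mathlib

noncomputable section

/-! ### Reduced simplicial homology -/

section Homology

variable (k : Type*) [Field k] {α : Type*}

open Classical in
/-- The simplicial boundary map on formal `k`-linear combinations of finite sets of vertices.
Every finite set is oriented by one fixed total order of the vertices, so that
`∂ {v₀ < ⋯ < vₘ} = ∑ⱼ (-1) ^ j • {v₀, …, vₘ} \ {vⱼ}`; the exponent `j` is the number of vertices
of the simplex that precede `vⱼ`. In particular `∂ {v} = ∅` (the augmentation) and `∂ ∅ = 0`. -/
def simplicialBoundary : (Finset α →₀ k) →ₗ[k] (Finset α →₀ k) :=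
  Finsupp.linearCombination k fun s : Finset α =>
    ∑ v ∈ s, Finsupp.single (s.erase v) ((-1 : k) ^ (s.filter fun w => WellOrderingRel w v).card)

/-- The module of augmented simplicial `i`-chains of `X`: formal combinations of faces with `i + 1`
vertices, where the empty set counts as the (only) face of dimension `-1`. -/
def simplicialChains (X : PreAbstractSimplicialComplex α) (i : ℤ) : Submodule k (Finset α →₀ k) :=
  Finsupp.supported k k {s : Finset α | (s = ∅ ∨ s ∈ X) ∧ (s.card : ℤ) = i + 1}

/-- The module of augmented simplicial `i`-cycles of `X`. -/
def simplicialCycles (X : PreAbstractSimplicialComplex α) (i : ℤ) : Submodule k (Finset α →₀ k) :=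
  simplicialChains k X i ⊓ LinearMap.ker (simplicialBoundary k)

/-- The module of simplicial `i`-boundaries of `X`. -/
def simplicialBoundaries (X : PreAbstractSimplicialComplex α) (i : ℤ) :
    Submodule k (Finset α →₀ k) :=
  (simplicialChains k X (i + 1)).map (simplicialBoundary k)

theorem simplicialBoundary_single [DecidableEq α] (s : Finset α) (a : k) :
    simplicialBoundary k (Finsupp.single s a) =
      ∑ v ∈ s, Finsupp.single (s.erase v)
        (a * (-1 : k) ^ (open Classical in s.filter fun w => WellOrderingRel w v).card) := by
  classical
  rw [simplicialBoundary, Finsupp.linearCombination_single, Finset.smul_sum]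
  refine Finset.sum_congr rfl fun v _ => ?_
  rw [Finsupp.smul_single, smul_eq_mul]
  congr!

theorem simplicialBoundary_boundary (c : Finset α →₀ k) :
    simplicialBoundary k (simplicialBoundary k c) = 0 := by
  classical
  induction c using Finsupp.induction_linear with
  | zero => simp
  | add f g hf hg => simp [hf, hg]
  | single s a =>
    rw [simplicialBoundary_single, map_sum]
    simp only [simplicialBoundary_single]
    rw [Finset.sum_sigma']
    refine Finset.sum_involution (fun p _ => ⟨p.2, p.1⟩) ?_ ?_ ?_ ?_
    · rintro ⟨v, w⟩ hvw
      simp only [Finset.mem_sigma, Finset.mem_erase] at hvw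
      obtain ⟨hv, hne, hw⟩ := hvw
      have key : ∀ x y : α, x ∈ s → y ∈ s → WellOrderingRel x y →
          (s.filter fun z => WellOrderingRel z y).card =
            ((s.erase x).filter fun z => WellOrderingRel z y).card + 1 := by
        intro x y hx hy hxy
        rw [Finset.filter_erase, Finset.card_erase_add_one]
        simp [hx, hxy]
      have key' : ∀ x y : α, WellOrderingRel x y →
          ((s.erase y).filter fun z => WellOrderingRel z x) =
            (s.filter fun z => WellOrderingRel z x) := by
        intro x y hxy
        rw [Finset.filter_erase, Finset.erase_eq_of_notMem]
        simp only [Finset.mem_filter, not_and]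
        exact fun _ h => asymm_of WellOrderingRel h hxy
      rw [Finset.erase_right_comm, ← Finsupp.single_add, Finsupp.single_eq_zero]
      rcases trichotomous_of WellOrderingRel v w with h | h | h
      · rw [key v w hv hw h, key' v w h]; ring
      · exact absurd h.symm hne
      · rw [key w v hw hv h, key' w v h]; ring
    · rintro ⟨v, w⟩ hvw _ h
      simp only [Finset.mem_sigma, Finset.mem_erase] at hvw
      simp only [Sigma.mk.injEq] at h
      exact hvw.2.1 h.1
    · rintro ⟨v, w⟩ hvw
      simp only [Finset.mem_sigma, Finset.mem_erase] at hvw ⊢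
      exact ⟨hvw.2.2, fun h => hvw.2.1 h.symm, hvw.1⟩
    · rintro ⟨v, w⟩ _
      rfl

theorem simplicialBoundaries_le_cycles (X : PreAbstractSimplicialComplex α) (i : ℤ) :
    simplicialBoundaries k X i ≤ simplicialCycles k X i := by
  classical
  rintro _ ⟨c, hc, rfl⟩
  refine ⟨?_, simplicialBoundary_boundary k c⟩
  have hc' : ∀ s ∈ c.support, (s = ∅ ∨ s ∈ X) ∧ (s.card : ℤ) = i + 1 + 1 :=
    fun s hs => (Finsupp.mem_supported k c).1 hc hs
  rw [← c.sum_single, Finsupp.sum, map_sum]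
  refine Submodule.sum_mem _ fun s hs => ?_
  rw [simplicialBoundary_single]
  refine Submodule.sum_mem _ fun v hv => ?_
  obtain ⟨h1, h2⟩ := hc' s hs
  refine Finsupp.single_mem_supported k _ ⟨?_, ?_⟩
  · rcases (s.erase v).eq_empty_or_nonempty with h | h
    · exact Or.inl h
    · rcases h1 with rfl | h1
      · simp at hv
      · exact Or.inr ((X.isRelLowerSet_faces h1).2 (Finset.erase_subset v s) h)
  · have := Finset.card_erase_add_one hv
    push_cast [← this] at h2
    linarith

/-- The quotient module `Z / B` of submodules `B ≤ Z` of one module. -/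
abbrev Subquotient {k : Type*} [Field k] {M : Type*} [AddCommGroup M] [Module k M]
    (Z B : Submodule k M) : Type _ :=
  Z ⧸ B.submoduleOf Z

/-- The `i`-th reduced simplicial homology `H̃ᵢ(X; k)`: cycles modulo boundaries of the augmented
simplicial chain complex. -/
abbrev reducedHomology (X : PreAbstractSimplicialComplex α) (i : ℤ) : Type _ :=
  Subquotient (simplicialCycles k X i) (simplicialBoundaries k X i)

theorem subsingleton_subquotient_iff {k : Type*} [Field k] {M : Type*} [AddCommGroup M]
    [Module k M] (Z B : Submodule k M) : Subsingleton (Subquotient Z B) ↔ Z ≤ B := by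
  rw [Submodule.Quotient.subsingleton_iff, Submodule.submoduleOf_eq_top]

theorem subsingleton_reducedHomology_iff (X : PreAbstractSimplicialComplex α) (i : ℤ) :
    Subsingleton (reducedHomology k X i) ↔ simplicialCycles k X i ≤ simplicialBoundaries k X i :=
  subsingleton_subquotient_iff _ _

/-- `H̃ᵢ(X; k) = 0` for every `i < dim X`; here `i < dim X` says that `X` has a face whose dimension
(number of vertices minus one) exceeds `i`, with `dim X = -1` if `X` has no vertices. -/
def IsHomologicallySpherical (X : PreAbstractSimplicialComplex α) : Prop :=
  ∀ i : ℤ, (∃ s : Finset α, (s = ∅ ∨ s ∈ X) ∧ i < (s.card : ℤ) - 1) →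
    Subsingleton (reducedHomology k X i)

end Homology

/-! ### Order complexes and Cohen-Macaulay posets -/

section Posets

/-- The order complex of a subset `S` of a poset: its faces are the nonempty finite chains
contained in `S`. -/
def orderComplex {P : Type*} [PartialOrder P] (S : Set P) : PreAbstractSimplicialComplex P where
  faces := {s | s.Nonempty ∧ (∀ x ∈ s, x ∈ S) ∧ IsChain (· ≤ ·) (s : Set P)}
  isRelLowerSet_faces := fun _ hs =>
    ⟨hs.1, fun _ hts ht =>
      ⟨ht, fun x hx => hs.2.1 x (hts hx), hs.2.2.mono (Finset.coe_subset.2 hts)⟩⟩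

/-- The open interval `(x, y)`, as a subset of `P`, for `x` and `y` in the poset obtained from `P`
by adjoining a new least element `0̂ = ⊥` and a new greatest element `1̂ = ⊤`. -/
def openInterval {P : Type*} [PartialOrder P] (x y : WithBot (WithTop P)) : Set P :=
  {p | x < ((p : WithTop P) : WithBot (WithTop P)) ∧ ((p : WithTop P) : WithBot (WithTop P)) < y}

/-- `P` is `k`-homologically Cohen-Macaulay: for all `x < y` in `P ∪ {0̂, 1̂}` the reduced homology
with coefficients in `k` of the order complex of the open interval `(x, y)` vanishes in all degrees
below the dimension of this complex. -/
def IsHomologicallyCohenMacaulay (k : Type*) [Field k] (P : Type*) [PartialOrder P] : Prop :=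
  ∀ x y : WithBot (WithTop P), x < y →
    IsHomologicallySpherical k (orderComplex (openInterval x y))

end Posets

/-- The clique complex of a graph: its faces are the nonempty finite cliques. -/
def cliqueComplex {α : Type*} (G : SimpleGraph α) : PreAbstractSimplicialComplex α where
  faces := {s | s.Nonempty ∧ G.IsClique (s : Set α)}
  isRelLowerSet_faces := fun _ hs =>
    ⟨hs.1, fun _ hts ht => ⟨ht, hs.2.subset (Finset.coe_subset.2 hts)⟩⟩

/-! ### Unitary spaces and their frames -/

section Unitary

variable {K : Type*} [Field K] {V : Type*} [AddCommGroup V] [Module K V] {τ : K →+* K}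

/-- `Ψ` is a non-degenerate Hermitian form with respect to `τ`, and `τ` is an automorphism of
order `2`; that is, `(V, Ψ)` is a unitary space. -/
structure IsUnitarySpace (τ : K →+* K) (Ψ : V →ₗ[K] V →ₛₗ[τ] K) : Prop where
  involutive : ∀ x : K, τ (τ x) = x
  ne_id : τ ≠ RingHom.id K
  hermitian : ∀ v w : V, Ψ v w = τ (Ψ w v)
  nondegenerate : ∀ v : V, (∀ w : V, Ψ v w = 0) → v = 0

/-- The restriction of `Ψ` to the subspace `S` is non-degenerate (`S` has zero radical). -/
def IsNondegenerateSubspace (Ψ : V →ₗ[K] V →ₛₗ[τ] K) (S : Submodule K V) : Prop :=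
  ∀ v ∈ S, (∀ w ∈ S, Ψ v w = 0) → v = 0

/-- The non-degenerate `1`-dimensional subspaces of `V`. -/
abbrev NondegenerateLine (Ψ : V →ₗ[K] V →ₛₗ[τ] K) : Type _ :=
  {S : Submodule K V // Module.finrank K S = 1 ∧ IsNondegenerateSubspace Ψ S}

/-- The graph on the non-degenerate `1`-dimensional subspaces in which two distinct subspaces are
adjacent if and only if they are orthogonal. -/
def orthogonalityGraph (Ψ : V →ₗ[K] V →ₛₗ[τ] K) : SimpleGraph (NondegenerateLine Ψ) :=
  SimpleGraph.fromRel fun S T => ∀ v ∈ S.1, ∀ w ∈ T.1, Ψ v w = 0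

/-- The frame complex: the clique complex of the orthogonality graph. Its faces are the nonempty
partial frames. -/
def frameComplex (Ψ : V →ₗ[K] V →ₛₗ[τ] K) : PreAbstractSimplicialComplex (NondegenerateLine Ψ) :=
  cliqueComplex (orthogonalityGraph Ψ)

/-- The reduced frame poset: the nonempty partial frames of size different from `dim V - 1`,
ordered by inclusion. -/
abbrev ReducedFramePoset (Ψ : V →ₗ[K] V →ₛₗ[τ] K) : Type _ :=
  {σ : Finset (NondegenerateLine Ψ) // σ ∈ frameComplex Ψ ∧ σ.card + 1 ≠ Module.finrank K V}

end Unitary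

end

/-! The argument has a linear-algebraic core (Garland's method over `ℚ`) and a combinatorial
transfer to the order complexes.

The link of a partial frame `x` is governed by `x^⊥`, a non-degenerate space of dimension `n - |x|`:
its faces are the partial frames of lines in `x^⊥`. For a degree `m` with `0 ≤ m ≤ n - |x| - 3`
write `n = |x| + m + M + 2`, so `M ≥ 1`. Given a cycle `f` of degree `m`, let `δ` be the coboundary.
Then `‖δf‖²` equals a degree-weighted norm of `f` minus the sum, over the simplices `t` with `m`
vertices, of the adjacency form of the link of `t` at the localization `f_t`. Since `∂f = 0`, each
`f_t` has sum zero, so only nontrivial eigenvalues of the orthogonality graph of a space of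
dimension `M + 2` matter. These are at most `q^M` (`sum_adj_le`), because a double count of common
perpendiculars bounds the squared adjacency operator by `q^(2M)` on functions of sum zero. Each
simplex with `m + 1` vertices extends in at least `q^(2M)(q² - q - 1)/(q² - 1)` ways
(`le_card_lines_mul`). The hypothesis `n < q + 1` gives `m + 1 ≤ q - 2`, which makes the degree term
win. Hence `∂δ` is injective, so surjective, on cycles, and every cycle is a boundary
(`cycles_le_boundaries_of_garland`). Linear algebra carries this from `ℚ` to `k`.

The intervals of the reduced poset are compared with simplicial complexes by an acyclic-carrier
argument (`cycles_le_boundaries_orderComplex`). Intervals unbounded above correspond to links: a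
partial frame of size `n - 1` has exactly one completion, so omitting that size still leaves a least
element above every partial frame needed. Bounded intervals correspond, below their top dimension,
to skeleta of a full simplex. The carriers are realized by explicit chain maps and homotopies that
fill by cones. -/

noncomputable section

/-! ### Cones and chain maps defined by apexes -/

section Cone

variable (k : Type*) [Field k] {α β : Type*}

open Classical in
/-- The sign with which the vertex `v` is deleted from, or added to, the simplex `s`. -/
def vertexSign (v : α) (s : Finset α) : k :=
  (-1) ^ (s.filter fun w => WellOrderingRel w v).card

theorem vertexSign_mul_self (v : α) (s : Finset α) : vertexSign k v s * vertexSign k v s = 1 := by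
  rw [vertexSign, ← mul_pow]; simp

theorem vertexSign_sq (v : α) (s : Finset α) : vertexSign k v s ^ 2 = 1 := by
  rw [sq, vertexSign_mul_self]

theorem vertexSign_insert_self [DecidableEq α] (v : α) (s : Finset α) :
    vertexSign k v (insert v s) = vertexSign k v s := by
  classical
  rw [vertexSign, vertexSign, Finset.filter_insert, if_neg (irrefl v)]

theorem vertexSign_erase_self [DecidableEq α] (v : α) (s : Finset α) :
    vertexSign k v (s.erase v) = vertexSign k v s := by
  by_cases h : v ∈ s
  · conv_rhs => rw [← Finset.insert_erase h, vertexSign_insert_self]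
  · rw [Finset.erase_eq_of_notMem h]

theorem vertexSign_insert_of_rel [DecidableEq α] {v w : α} {s : Finset α} (hw : w ∉ s)
    (h : WellOrderingRel w v) : vertexSign k v (insert w s) = - vertexSign k v s := by
  classical
  rw [vertexSign, vertexSign, Finset.filter_insert, if_pos h, Finset.card_insert_of_notMem, pow_succ]
  · ring
  · simp [hw]

theorem vertexSign_insert_of_not_rel [DecidableEq α] {v w : α} {s : Finset α}
    (h : ¬ WellOrderingRel w v) : vertexSign k v (insert w s) = vertexSign k v s := by
  classical
  rw [vertexSign, vertexSign, Finset.filter_insert, if_neg h]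

/-- Exactly one of `v`, `w` precedes the other, so exactly one of the two signs changes. This is the
cancellation behind the cone formula and the minus sign in Garland's identity. -/
theorem vertexSign_swap [DecidableEq α] {v w : α} {s : Finset α} (hvw : v ≠ w) (hv : v ∉ s)
    (hw : w ∉ s) : vertexSign k v (insert w s) * vertexSign k w (insert v s) =
      - (vertexSign k v s * vertexSign k w s) := by
  rcases trichotomous_of WellOrderingRel v w with h | h | h
  · rw [vertexSign_insert_of_not_rel k fun h' => asymm_of WellOrderingRel h h',
      vertexSign_insert_of_rel k hv h]; ring
  · exact absurd h hvw
  · rw [vertexSign_insert_of_not_rel k (v := w) fun h' => asymm_of WellOrderingRel h h',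
      vertexSign_insert_of_rel k hw h]; ring

theorem simplicialBoundary_single_one [DecidableEq α] (s : Finset α) :
    simplicialBoundary k (Finsupp.single s 1) =
      ∑ v ∈ s, vertexSign k v s • Finsupp.single (s.erase v) 1 := by
  rw [simplicialBoundary_single]
  simp [vertexSign]

open Classical in
/-- The cone operator with apex `v`, which adds the vertex `v` to each simplex. -/
def cone (v : α) : (Finset α →₀ k) →ₗ[k] (Finset α →₀ k) :=
  Finsupp.linearCombination k fun s =>
    if v ∈ s then 0 else vertexSign k v s • Finsupp.single (insert v s) 1

theorem cone_single_of_mem {v : α} {s : Finset α} (h : v ∈ s) (a : k) :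
    cone k v (Finsupp.single s a) = 0 := by
  simp [cone, h]

theorem cone_single_of_notMem [DecidableEq α] {v : α} {s : Finset α} (h : v ∉ s) :
    cone k v (Finsupp.single s 1) = vertexSign k v s • Finsupp.single (insert v s) 1 := by
  rw [cone, Finsupp.linearCombination_single, if_neg h, one_smul]
  congr!

/-- On a simplex containing `v` only the deletion of `v` survives coning; otherwise the mixed terms
cancel by `vertexSign_swap`. Consequently a cycle bounds its own cone. -/
theorem simplicialBoundary_cone_add (v : α) (c : Finset α →₀ k) :
    simplicialBoundary k (cone k v c) + cone k v (simplicialBoundary k c) = c := by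
  classical
  suffices h : simplicialBoundary k ∘ₗ cone k v + cone k v ∘ₗ simplicialBoundary k =
      LinearMap.id from LinearMap.congr_fun h c
  ext1 s
  ext1
  simp only [LinearMap.comp_apply, LinearMap.add_apply, Finsupp.lsingle_apply, LinearMap.id_apply]
  rw [simplicialBoundary_single_one, map_sum]
  by_cases hv : v ∈ s
  · rw [cone_single_of_mem k hv, map_zero, zero_add, Finset.sum_eq_single v]
    · rw [map_smul, cone_single_of_notMem k (Finset.notMem_erase v s), vertexSign_erase_self,
        Finset.insert_erase hv, smul_smul, vertexSign_mul_self, one_smul]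
    · intro w _ hw
      rw [map_smul, cone_single_of_mem k (Finset.mem_erase.2 ⟨hw.symm, hv⟩), smul_zero]
    · exact fun h => absurd hv h
  · rw [cone_single_of_notMem k hv, map_smul, simplicialBoundary_single_one,
      Finset.sum_insert hv, Finset.erase_insert hv, smul_add, smul_smul, vertexSign_insert_self,
      vertexSign_mul_self, one_smul, add_assoc, Finset.smul_sum, ← Finset.sum_add_distrib,
      Finset.sum_eq_zero, add_zero]
    intro w hw
    have hvw : v ≠ w := fun h => hv (h ▸ hw)
    have hv' : v ∉ s.erase w := fun h => hv (Finset.mem_of_mem_erase h)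
    rw [map_smul, cone_single_of_notMem k hv', smul_smul, smul_smul,
      Finset.erase_insert_of_ne hvw, ← add_smul]
    have h1 := vertexSign_swap k hvw hv' (Finset.notMem_erase w s)
    have h2 : vertexSign k w (insert v s) = vertexSign k w (insert v (s.erase w)) := by
      rw [← vertexSign_erase_self, Finset.erase_insert_of_ne hvw]
    rw [Finset.insert_erase hw] at h1
    rw [h2, h1, vertexSign_erase_self k w s]
    convert zero_smul k _ using 2
    ring

theorem map_mem_supported {M : Type*} [AddCommGroup M] [Module k M]
    (L : (Finset α →₀ k) →ₗ[k] M) {A : Set (Finset α)} {N : Submodule k M}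
    (h : ∀ s ∈ A, L (Finsupp.single s 1) ∈ N) {c : Finset α →₀ k}
    (hc : c ∈ Finsupp.supported k k A) : L c ∈ N := by
  rw [← c.sum_single, Finsupp.sum, map_sum]
  refine N.sum_mem fun s hs => ?_
  rw [← mul_one (c s), ← smul_eq_mul, ← Finsupp.smul_single, map_smul]
  exact N.smul_mem _ (h s ((Finsupp.mem_supported k c).1 hc hs))

theorem cone_mem_supported [DecidableEq α] {v : α} {A B : Set (Finset α)}
    (h : ∀ s ∈ A, v ∉ s → insert v s ∈ B) {c : Finset α →₀ k}
    (hc : c ∈ Finsupp.supported k k A) : cone k v c ∈ Finsupp.supported k k B := by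
  refine map_mem_supported k (cone k v) (fun s hs => ?_) hc
  by_cases hv : v ∈ s
  · rw [cone_single_of_mem k hv]; exact Submodule.zero_mem _
  · rw [cone_single_of_notMem k hv]
    exact Submodule.smul_mem _ _ (Finsupp.single_mem_supported k _ (h s hs hv))

open Classical in
/-- Auxiliary function for `coneRec`. -/
def coneRecAux (a : Finset α → β) (g : Finset α → (Finset β →₀ k)) (e : k) (s : Finset α) :
    Finset β →₀ k :=
  if s = ∅ then g ∅ else
    cone k (a s) (g s + e • ∑ v ∈ s.attach, vertexSign k v.1 s • coneRecAux a g e (s.erase v.1))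
termination_by s.card
decreasing_by exact Finset.card_erase_lt_of_mem v.2

/-- The linear map `R` with `R ∅ = g ∅` and `R s = cone (a s) (g s + e • R (∂ s))` for `s ≠ ∅`. -/
def coneRec (a : Finset α → β) (g : Finset α → (Finset β →₀ k)) (e : k) :
    (Finset α →₀ k) →ₗ[k] (Finset β →₀ k) :=
  Finsupp.linearCombination k (coneRecAux k a g e)

variable (a : Finset α → β) (g : Finset α → (Finset β →₀ k)) (e : k)

theorem coneRec_empty : coneRec k a g e (Finsupp.single ∅ 1) = g ∅ := by
  rw [coneRec, Finsupp.linearCombination_single, one_smul, coneRecAux, if_pos rfl]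

theorem coneRec_single {s : Finset α} (hs : s ≠ ∅) : coneRec k a g e (Finsupp.single s 1) =
    cone k (a s) (g s + e • coneRec k a g e (simplicialBoundary k (Finsupp.single s 1))) := by
  classical
  rw [coneRec, Finsupp.linearCombination_single, one_smul, coneRecAux, if_neg hs,
    simplicialBoundary_single_one, map_sum]
  simp only [map_smul, Finsupp.linearCombination_single, one_smul]
  rw [← Finset.sum_attach s]

/-- `C` is a carrier. Since `R` is built by coning, induction on the number of vertices only needs
that coning with apex `a s` moves the carriers of the facets of `s`, and the support of `g s`, into
`C s`. -/
theorem coneRec_mem_supported [DecidableEq α] [DecidableEq β] {D : Set (Finset α)}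
    {C : Finset α → Set (Finset β)} (hD : ∀ s ∈ D, ∀ v ∈ s, s.erase v ∈ D)
    (h0 : g ∅ ∈ Finsupp.supported k k (C ∅))
    (hg : ∀ s ∈ D, s ≠ ∅ → g s ∈ Finsupp.supported k k {c | a s ∉ c → insert (a s) c ∈ C s})
    (hC : ∀ s ∈ D, ∀ v ∈ s, ∀ c ∈ C (s.erase v), a s ∉ c → insert (a s) c ∈ C s)
    {s : Finset α} (hs : s ∈ D) :
    coneRec k a g e (Finsupp.single s 1) ∈ Finsupp.supported k k (C s) := by
  induction hn : s.card using Nat.strong_induction_on generalizing s with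
  | _ n ih =>
    by_cases h : s = ∅
    · rw [h, coneRec_empty]; exact h0
    · rw [coneRec_single k a g e h]
      refine cone_mem_supported k (A := {c | a s ∉ c → insert (a s) c ∈ C s})
        (fun c hc => hc) (Submodule.add_mem _ (hg s hs h) (Submodule.smul_mem _ _ ?_))
      rw [simplicialBoundary_single_one, map_sum]
      refine Submodule.sum_mem _ fun v hv => ?_
      rw [map_smul]
      refine Submodule.smul_mem _ _ (Finsupp.supported_mono (fun c hc => hC s hs v hv c hc)
        (ih _ ?_ (hD s hs v hv) rfl))
      rw [← hn]; exact Finset.card_erase_lt_of_mem hv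

theorem simplicialBoundary_empty :
    simplicialBoundary k (Finsupp.single (∅ : Finset α) 1) = 0 := by
  classical
  rw [simplicialBoundary_single_one, Finset.sum_empty]

/-- A property of linear maps on chains that passes from `∂ s` to `s` holds for all chains. -/
theorem eq_of_boundary_eq {M : Type*} [AddCommGroup M] [Module k M]
    (L L' : (Finset α →₀ k) →ₗ[k] M)
    (h : ∀ s : Finset α, L (simplicialBoundary k (Finsupp.single s 1)) =
      L' (simplicialBoundary k (Finsupp.single s 1)) →
      L (Finsupp.single s 1) = L' (Finsupp.single s 1)) (c : Finset α →₀ k) : L c = L' c := by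
  classical
  suffices H : L = L' by rw [H]
  ext1 s
  ext1
  simp only [LinearMap.comp_apply, Finsupp.lsingle_apply]
  induction hn : s.card using Nat.strong_induction_on generalizing s with
  | _ n ih =>
    refine h s ?_
    simp only [simplicialBoundary_single_one, map_sum, map_smul]
    refine Finset.sum_congr rfl fun v hv => ?_
    rw [ih _ (hn ▸ Finset.card_erase_lt_of_mem hv) _ rfl]

open Classical in
/-- The augmentation-preserving chain map with `s ↦ cone (a s) (image of ∂ s)`. -/
def apexMap : (Finset α →₀ k) →ₗ[k] (Finset β →₀ k) :=
  coneRec k a (fun s => if s = ∅ then Finsupp.single ∅ 1 else 0) 1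

theorem apexMap_empty : apexMap k a (Finsupp.single ∅ 1) = Finsupp.single ∅ 1 := by
  rw [apexMap, coneRec_empty, if_pos rfl]

/-- Inductively the image of `∂ s` is a cycle, and the cone over a cycle is a chain bounding it. -/
theorem simplicialBoundary_apexMap (c : Finset α →₀ k) :
    simplicialBoundary k (apexMap k a c) = apexMap k a (simplicialBoundary k c) := by
  refine eq_of_boundary_eq k (simplicialBoundary k ∘ₗ apexMap k a)
    (apexMap k a ∘ₗ simplicialBoundary k) (fun s hs => ?_) c
  simp only [LinearMap.comp_apply] at hs ⊢
  by_cases h : s = ∅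
  · rw [h, apexMap_empty, simplicialBoundary_empty, simplicialBoundary_empty, map_zero]
  · rw [apexMap, coneRec_single k _ _ _ h, if_neg h, zero_add, one_smul, ← apexMap]
    rw [simplicialBoundary_boundary, map_zero] at hs
    conv_rhs => rw [← simplicialBoundary_cone_add k (a s)
      (apexMap k a (simplicialBoundary k (Finsupp.single s 1))), hs, map_zero, add_zero]

/-- The chain homotopy, built with cones of apex `b s`, between the identity and `θ`. -/
def apexHomotopy (b : Finset β → β) (θ : (Finset β →₀ k) →ₗ[k] (Finset β →₀ k)) :
    (Finset β →₀ k) →ₗ[k] (Finset β →₀ k) :=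
  coneRec k b (fun s => Finsupp.single s 1 - θ (Finsupp.single s 1)) (-1)

/-- Inductively `s - θ s - H (∂ s)` is a cycle, where `H` is the homotopy, and `H s` is defined as
its cone. -/
theorem apexHomotopy_spec (b : Finset β → β) (θ : (Finset β →₀ k) →ₗ[k] (Finset β →₀ k))
    (hθ : ∀ c, simplicialBoundary k (θ c) = θ (simplicialBoundary k c))
    (h0 : θ (Finsupp.single ∅ 1) = Finsupp.single ∅ 1) (c : Finset β →₀ k) :
    simplicialBoundary k (apexHomotopy k b θ c) + apexHomotopy k b θ (simplicialBoundary k c) =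
      c - θ c := by
  refine eq_of_boundary_eq k
    (simplicialBoundary k ∘ₗ apexHomotopy k b θ + apexHomotopy k b θ ∘ₗ simplicialBoundary k)
    (LinearMap.id - θ) (fun s hs => ?_) c
  simp only [LinearMap.comp_apply, LinearMap.add_apply, LinearMap.sub_apply,
    LinearMap.id_apply] at hs ⊢
  by_cases h : s = ∅
  · rw [h, apexHomotopy, coneRec_empty, h0, sub_self, simplicialBoundary_empty, map_zero, map_zero,
      add_zero]
  · rw [simplicialBoundary_boundary, map_zero, add_zero] at hs
    have h1 : apexHomotopy k b θ (Finsupp.single s 1) = cone k (b s) (Finsupp.single s 1 -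
        θ (Finsupp.single s 1) -
        apexHomotopy k b θ (simplicialBoundary k (Finsupp.single s 1))) := by
      rw [apexHomotopy, coneRec_single k _ _ _ h, neg_smul, one_smul, ← sub_eq_add_neg]
    have h2 := simplicialBoundary_cone_add k (b s) (Finsupp.single s 1 -
        θ (Finsupp.single s 1) -
        apexHomotopy k b θ (simplicialBoundary k (Finsupp.single s 1)))
    rw [map_sub (simplicialBoundary k), map_sub (simplicialBoundary k) (Finsupp.single s 1), hs, hθ,
      sub_self, map_zero, add_zero] at h2
    rw [h1, h2, sub_add_cancel]

end Cone

/-! ### Vanishing of homology -/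

section Vanishing

variable (k : Type*) [Field k] {α : Type*}

theorem cycles_le_boundaries_of_cone [DecidableEq α] (X : PreAbstractSimplicialComplex α) (v : α)
    (h : ∀ s : Finset α, s = ∅ ∨ s ∈ X → insert v s ∈ X) (i : ℤ) :
    simplicialCycles k X i ≤ simplicialBoundaries k X i := by
  rintro z ⟨hz, hz'⟩
  refine ⟨cone k v z, cone_mem_supported k ?_ hz, ?_⟩
  · rintro s ⟨hs, hs'⟩ hv
    refine ⟨Or.inr (h s hs), ?_⟩
    rw [Finset.card_insert_of_notMem hv, ← hs']; push_cast; rfl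
  · have := simplicialBoundary_cone_add k v z
    rwa [LinearMap.mem_ker.1 hz', map_zero, add_zero] at this

theorem cycles_le_boundaries_of_lt_neg_one (X : PreAbstractSimplicialComplex α) {i : ℤ}
    (hi : i < -1) : simplicialCycles k X i ≤ simplicialBoundaries k X i := by
  rintro z ⟨hz, _⟩
  have : z = 0 := by
    rw [← Finsupp.support_eq_empty, Finset.eq_empty_iff_forall_notMem]
    intro s hs
    have := ((Finsupp.mem_supported k z).1 hz hs).2
    omega
  rw [this]; exact Submodule.zero_mem _

/-- A chain of degree `-1` is a multiple of `∅`, so its cone stays in `X` as soon as the apex is a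
vertex. -/
theorem cycles_le_boundaries_neg_one (X : PreAbstractSimplicialComplex α) {v : α}
    (hv : {v} ∈ X) : simplicialCycles k X (-1) ≤ simplicialBoundaries k X (-1) := by
  classical
  rintro z ⟨hz, hz'⟩
  refine ⟨cone k v z, cone_mem_supported k (fun s hs _ => ?_) hz, ?_⟩
  · obtain rfl : s = ∅ := by rw [← Finset.card_eq_zero]; have := hs.2; omega
    exact ⟨Or.inr (by simpa using hv), by simp⟩
  · have := simplicialBoundary_cone_add k v z
    rwa [LinearMap.mem_ker.1 hz', map_zero, add_zero] at this

/-- Vanishing of homology over `ℚ` implies vanishing over every field of characteristic zero. -/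
theorem cycles_le_boundaries_of_rat [CharZero k] (X : PreAbstractSimplicialComplex α) (i : ℤ)
    (h : simplicialCycles ℚ X i ≤ simplicialBoundaries ℚ X i) :
    simplicialCycles k X i ≤ simplicialBoundaries k X i := by
  classical
  let _ : Algebra ℚ k := DivisionRing.toRatAlgebra
  rintro z ⟨hz, hz'⟩
  -- The boundary has coefficients `±1`, so the coordinates of a cycle in a `ℚ`-basis of `k` are
  -- rational cycles. Each is bounded separately and the fillings are recombined.
  let b := Module.Basis.ofVectorSpace ℚ k
  let coord (j) : (Finset α →₀ k) →ₗ[ℚ] (Finset α →₀ ℚ) := Finsupp.mapRange.linearMap (b.coord j)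
  let ext : (Finset α →₀ ℚ) →ₗ[ℚ] (Finset α →₀ k) :=
    Finsupp.mapRange.linearMap (Algebra.linearMap ℚ k)
  have hcoord : ∀ j c, simplicialBoundary ℚ (coord j c) = coord j (simplicialBoundary k c) := by
    intro j c
    induction c using Finsupp.induction_linear with
    | zero => simp
    | add f g hf hg => simp only [map_add, hf, hg]
    | single s a =>
      simp only [coord, Finsupp.mapRange.linearMap_apply, Finsupp.mapRange_single,
        simplicialBoundary_single, map_sum]
      refine Finset.sum_congr rfl fun v _ => ?_
      congr 1
      rcases Nat.even_or_odd (s.filter fun w => WellOrderingRel w v).card with h1 | h1 <;>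
      simp [h1.neg_one_pow]
  have hext : ∀ c, simplicialBoundary k (ext c) = ext (simplicialBoundary ℚ c) := by
    intro c
    induction c using Finsupp.induction_linear with
    | zero => simp
    | add f g hf hg => simp only [map_add, hf, hg]
    | single s a =>
      simp only [ext, Finsupp.mapRange.linearMap_apply, Finsupp.mapRange_single,
        simplicialBoundary_single, map_sum]
      refine Finset.sum_congr rfl fun v _ => ?_
      congr 1
      simp
  have hsupp : ∀ j, coord j z ∈ simplicialBoundaries ℚ X i := by
    refine fun j => h ⟨?_, ?_⟩
    · refine (Finsupp.mem_supported _ _).2 fun s hs => (Finsupp.mem_supported _ _).1 hz ?_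
      exact Finsupp.support_mapRange (hf := map_zero _) hs
    · refine LinearMap.mem_ker.2 ?_
      rw [hcoord, LinearMap.mem_ker.1 hz', map_zero]
  choose w hw hwz using hsupp
  -- The finitely many basis vectors that occur in some coefficient of `z`.
  let J := z.support.biUnion fun s => (b.repr (z s)).support
  refine ⟨∑ j ∈ J, b j • ext (w j), Submodule.sum_mem _ fun j _ => Submodule.smul_mem _ _ ?_, ?_⟩
  · refine (Finsupp.mem_supported _ _).2 fun s hs => (Finsupp.mem_supported _ _).1 (hw j) ?_
    exact Finsupp.support_mapRange (hf := map_zero _) hs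
  · simp only [map_sum, map_smul, hext, hwz]
    ext s
    simp only [Finsupp.finsetSum_apply, Finsupp.smul_apply, ext, coord,
      Finsupp.mapRange.linearMap_apply, Finsupp.mapRange_apply]
    conv_rhs => rw [← b.linearCombination_repr (z s), Finsupp.linearCombination_apply]
    rw [Finsupp.sum_of_support_subset (s := J)]
    · refine Finset.sum_congr rfl fun j _ => ?_
      rw [smul_eq_mul, mul_comm, Algebra.smul_def]; rfl
    · intro j hj
      refine Finset.mem_biUnion.2 ⟨s, ?_, hj⟩
      rw [Finsupp.mem_support_iff]
      rintro h0
      rw [h0] at hj; simp at hj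
    · simp

end Vanishing

/-! ### Comparison of a complex with an order complex -/

section Transfer

variable (k : Type*) [Field k] {α P : Type*} [PartialOrder P]

theorem erase_isFaceOrEmpty [DecidableEq α] (X : PreAbstractSimplicialComplex α) {s : Finset α}
    (hs : s = ∅ ∨ s ∈ X) (v : α) : s.erase v = ∅ ∨ s.erase v ∈ X := by
  rcases (s.erase v).eq_empty_or_nonempty with h | h
  · exact Or.inl h
  · rcases hs with rfl | hs
    · simp at h
    · exact Or.inr ((X.isRelLowerSet_faces hs).2 (Finset.erase_subset v s) h)

theorem exists_top_of_isChain {c : Finset P} (hc : IsChain (· ≤ ·) (c : Set P)) (h : c.Nonempty) :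
    ∃ p ∈ c, ∀ q ∈ c, q ≤ p := by
  obtain ⟨p, hp⟩ := c.exists_maximal h
  refine ⟨p, hp.1, fun q hq => ?_⟩
  rcases hc.total hq hp.1 with h | h
  · exact h
  · exact hp.2 hq h

/-- Homology vanishes in degree `i` for the order complex of `S` if it does for `X`, when `X` and
`S` are related by compatible carriers: `u p` is a face of `X` for each `p ∈ S`, and `t s ∈ S` for
each face `s` of `X` of dimension at most `i + 1`. -/
theorem cycles_le_boundaries_orderComplex [Nonempty α] (X : PreAbstractSimplicialComplex α)
    (S : Set P) (u : P → Finset α) (t : Finset α → P) (i : ℤ)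
    (hu : ∀ p ∈ S, u p ∈ X) (hum : ∀ p ∈ S, ∀ q ∈ S, p ≤ q → u p ⊆ u q)
    (ht : ∀ s ∈ X, (s.card : ℤ) ≤ i + 2 → t s ∈ S)
    (htm : ∀ s ∈ X, ∀ s' ∈ X, (s'.card : ℤ) ≤ i + 2 → s ⊆ s' → t s ≤ t s')
    (htu : ∀ s ∈ X, (s.card : ℤ) ≤ i + 2 → ∀ p ∈ S, s ⊆ u p → t s ≤ p)
    (h : simplicialCycles k X i ≤ simplicialBoundaries k X i) :
    simplicialCycles k (orderComplex S) i ≤ simplicialBoundaries k (orderComplex S) i := by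
  classical
  let Ch : Set (Finset P) := {c | (∀ p ∈ c, p ∈ S) ∧ IsChain (· ≤ ·) (c : Set P)}
  have hface : ∀ c : Finset P, (c = ∅ ∨ c ∈ orderComplex S) ↔ c ∈ Ch := by
    intro c
    constructor
    · rintro (rfl | hc)
      · exact ⟨by simp, by simp⟩
      · exact hc.2
    · intro hc
      rcases c.eq_empty_or_nonempty with h | h
      · exact Or.inl h
      · exact Or.inr ⟨h, hc⟩
  have herase : ∀ c ∈ Ch, ∀ p ∈ c, c.erase p ∈ Ch := fun c hc p _ =>
    ⟨fun q hq => hc.1 q (Finset.mem_of_mem_erase hq),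
      hc.2.mono (Finset.coe_subset.2 (Finset.erase_subset p c))⟩
  have hinsert : ∀ c ∈ Ch, ∀ p ∈ S, (∀ q ∈ c, q ≤ p) → insert p c ∈ Ch := by
    intro c hc p hp hcp
    refine ⟨fun q hq => ?_, ?_⟩
    · rcases Finset.mem_insert.1 hq with rfl | hq
      exacts [hp, hc.1 q hq]
    · rw [Finset.coe_insert]
      exact hc.2.insert fun q hq _ => Or.inr (hcp q hq)
  obtain ⟨top, htop⟩ : ∃ top : Finset P → P, ∀ c ∈ Ch, c.Nonempty →
      top c ∈ c ∧ ∀ q ∈ c, q ≤ top c := by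
    refine ⟨fun c => if h : ∃ p ∈ c, ∀ q ∈ c, q ≤ p then h.choose else t ∅, fun c hc hne => ?_⟩
    have := exists_top_of_isChain hc.2 hne
    simp only [this, dif_pos]
    exact this.choose_spec
  obtain ⟨vx, hvx⟩ : ∃ vx : Finset P → α, ∀ c ∈ Ch, c.Nonempty → vx c ∈ u (top c) := by
    refine ⟨fun c => if h : (u (top c)).Nonempty then h.choose else Classical.arbitrary α,
      fun c hc hne => ?_⟩
    have : (u (top c)).Nonempty :=
      (X.isRelLowerSet_faces (hu _ (hc.1 _ (htop c hc hne).1))).1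
    simp only [this, dif_pos]
    exact this.choose_spec
  let D : Set (Finset α) := {s | (s = ∅ ∨ s ∈ X) ∧ (s.card : ℤ) ≤ i + 2}
  -- The carriers: `s` goes to chains below `t s`, `c` goes to simplices inside `u (top c)`, and the
  -- homotopy on `c` stays below elements of `c`. The cardinality conditions record that degrees are
  -- preserved, or raised by one for the homotopy.
  let Cφ : Finset α → Set (Finset P) := fun s => {c | c.card = s.card ∧ c ∈ Ch ∧ ∀ p ∈ c, p ≤ t s}
  let Cψ : Finset P → Set (Finset α) := fun c => {s | s.card = c.card ∧ ∀ v ∈ s, ∃ p ∈ c, v ∈ u p}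
  let CD : Finset P → Set (Finset P) := fun c =>
    {d | d.card = c.card + 1 ∧ d ∈ Ch ∧ ∀ p ∈ d, ∃ q ∈ c, p ≤ q}
  have hφ : ∀ s ∈ D, apexMap k t (Finsupp.single s 1) ∈ Finsupp.supported k k (Cφ s) := by
    intro s hs
    refine coneRec_mem_supported k t _ 1 (D := D) (C := Cφ) ?_ ?_ ?_ ?_ hs
    · intro s hs v hv
      refine ⟨erase_isFaceOrEmpty X hs.1 v, le_trans ?_ hs.2⟩
      exact_mod_cast Finset.card_erase_le
    · rw [if_pos rfl]
      exact Finsupp.single_mem_supported k _ ⟨rfl, by simp [Ch], by simp⟩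
    · intro s _ hs
      rw [if_neg hs]; exact Submodule.zero_mem _
    · rintro s hs v hv c ⟨hc1, hc2, hc3⟩ hc4
      have hsX : s ∈ X := hs.1.resolve_left (Finset.ne_empty_of_mem hv)
      have hle : ∀ q ∈ c, q ≤ t s := by
        intro q hq
        refine (hc3 q hq).trans (htm _ ?_ s hsX hs.2 (Finset.erase_subset v s))
        refine (erase_isFaceOrEmpty X hs.1 v).resolve_left fun h0 => ?_
        rw [h0, Finset.card_empty, Finset.card_eq_zero] at hc1
        rw [hc1] at hq; simp at hq
      refine ⟨?_, hinsert c hc2 _ (ht s hsX hs.2) hle, fun p hp => ?_⟩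
      · rw [Finset.card_insert_of_notMem hc4, hc1, Finset.card_erase_add_one hv]
      · rcases Finset.mem_insert.1 hp with rfl | hp
        exacts [le_rfl, hle p hp]
  have hψ : ∀ c ∈ Ch, apexMap k vx (Finsupp.single c 1) ∈ Finsupp.supported k k (Cψ c) := by
    intro c hc
    refine coneRec_mem_supported k vx _ 1 (D := Ch) (C := Cψ) herase ?_ ?_ ?_ hc
    · rw [if_pos rfl]
      exact Finsupp.single_mem_supported k _ ⟨rfl, by simp⟩
    · intro s _ hs
      rw [if_neg hs]; exact Submodule.zero_mem _
    · rintro c hc p hp s ⟨hs1, hs2⟩ hs3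
      have hne : c.Nonempty := ⟨p, hp⟩
      refine ⟨?_, fun v hv => ?_⟩
      · rw [Finset.card_insert_of_notMem hs3, hs1, Finset.card_erase_add_one hp]
      · rcases Finset.mem_insert.1 hv with rfl | hv
        · exact ⟨top c, (htop c hc hne).1, hvx c hc hne⟩
        · obtain ⟨q, hq, hvq⟩ := hs2 v hv
          exact ⟨q, Finset.mem_of_mem_erase hq, hvq⟩
  have hsub : ∀ c ∈ Ch, c.Nonempty → ∀ s ∈ Cψ c, s ⊆ u (top c) := by
    intro c hc hne s hs v hv
    obtain ⟨p, hp, hvp⟩ := hs.2 v hv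
    exact hum p (hc.1 p hp) _ (hc.1 _ (htop c hc hne).1) ((htop c hc hne).2 p hp) hvp
  have hψX : ∀ c ∈ Ch, ∀ s ∈ Cψ c, s = ∅ ∨ s ∈ X := by
    intro c hc s hs
    rcases s.eq_empty_or_nonempty with h0 | h0
    · exact Or.inl h0
    · have hne : c.Nonempty := by
        obtain ⟨v, hv⟩ := h0
        obtain ⟨p, hp, _⟩ := hs.2 v hv
        exact ⟨p, hp⟩
      exact Or.inr ((X.isRelLowerSet_faces (hu _ (hc.1 _ (htop c hc hne).1))).2
        (hsub c hc hne s hs) h0)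
  let θ : (Finset P →₀ k) →ₗ[k] (Finset P →₀ k) := apexMap k t ∘ₗ apexMap k vx
  have hθ : ∀ c, simplicialBoundary k (θ c) = θ (simplicialBoundary k c) := by
    intro c
    simp only [θ, LinearMap.comp_apply, simplicialBoundary_apexMap]
  have hθ0 : θ (Finsupp.single ∅ 1) = Finsupp.single ∅ 1 := by
    simp only [θ, LinearMap.comp_apply, apexMap_empty]
  -- `z` has degree `i`, so chains with at most `i + 1` elements suffice. This keeps the
  -- intermediate simplices in the range where `t` is controlled.
  have hD : ∀ c ∈ {c | c ∈ Ch ∧ (c.card : ℤ) ≤ i + 1},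
      apexHomotopy k top θ (Finsupp.single c 1) ∈ Finsupp.supported k k (CD c) := by
    intro c hc
    refine coneRec_mem_supported k top _ (-1) (D := {c | c ∈ Ch ∧ (c.card : ℤ) ≤ i + 1})
      (C := CD) ?_ ?_ ?_ ?_ hc
    · rintro c ⟨hc, hc'⟩ p hp
      refine ⟨herase c hc p hp, le_trans ?_ hc'⟩
      exact_mod_cast Finset.card_erase_le
    · rw [hθ0, sub_self]; exact Submodule.zero_mem _
    · rintro c ⟨hc, hc'⟩ hne
      have hne := Finset.nonempty_iff_ne_empty.2 hne
      have key : ∀ d ∈ Ch, d.card = c.card → (∀ p ∈ d, p ≤ top c) → top c ∉ d →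
          insert (top c) d ∈ CD c := by
        intro d hd hdc hdt hd'
        refine ⟨?_, hinsert d hd _ (hc.1 _ (htop c hc hne).1) hdt, fun p hp => ?_⟩
        · rw [Finset.card_insert_of_notMem hd', hdc]
        · refine ⟨top c, (htop c hc hne).1, ?_⟩
          rcases Finset.mem_insert.1 hp with rfl | hp
          exacts [le_rfl, hdt p hp]
      refine Submodule.sub_mem _ (Finsupp.single_mem_supported k _ ?_) ?_
      · exact key c hc rfl (htop c hc hne).2
      · refine map_mem_supported k (apexMap k t) (fun s hs => ?_) (hψ c hc)
        have hsX := hψX c hc s hs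
        have hsc : (s.card : ℤ) ≤ i + 2 := by rw [hs.1]; omega
        refine Finsupp.supported_mono ?_ (hφ s ⟨hsX, hsc⟩)
        rintro d ⟨hd1, hd2, hd3⟩
        refine key d hd2 (hd1.trans hs.1) fun p hp => (hd3 p hp).trans ?_
        refine htu s (hsX.resolve_left fun h0 => ?_) hsc _ (hc.1 _ (htop c hc hne).1)
          (hsub c hc hne s hs)
        rw [h0] at hd1
        rw [Finset.card_empty, Finset.card_eq_zero] at hd1
        rw [hd1] at hp; simp at hp
    · rintro c ⟨hc, hc'⟩ p hp d ⟨hd1, hd2, hd3⟩ hd4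
      have hne : c.Nonempty := ⟨p, hp⟩
      refine ⟨?_, hinsert d hd2 _ (hc.1 _ (htop c hc hne).1) fun q hq => ?_, fun q hq => ?_⟩
      · rw [Finset.card_insert_of_notMem hd4, hd1, Finset.card_erase_add_one hp]
      · obtain ⟨r, hr, hqr⟩ := hd3 q hq
        exact hqr.trans ((htop c hc hne).2 r (Finset.mem_of_mem_erase hr))
      · rcases Finset.mem_insert.1 hq with rfl | hq
        · exact ⟨_, (htop c hc hne).1, le_rfl⟩
        · obtain ⟨r, hr, hqr⟩ := hd3 q hq
          exact ⟨r, Finset.mem_of_mem_erase hr, hqr⟩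
  rintro z ⟨hz, hz'⟩
  have hz0 := LinearMap.mem_ker.1 hz'
  have hψz : apexMap k vx z ∈ simplicialCycles k X i := by
    refine ⟨map_mem_supported k _ (fun c hc => ?_) hz, LinearMap.mem_ker.2 ?_⟩
    · have hcC := (hface c).1 hc.1
      have hsub' : Cψ c ⊆ {s | (s = ∅ ∨ s ∈ X) ∧ (s.card : ℤ) = i + 1} := fun s hs =>
        ⟨hψX c hcC s hs, by rw [hs.1, hc.2]⟩
      exact Finsupp.supported_mono hsub' (hψ c hcC)
    · rw [simplicialBoundary_apexMap, hz0, map_zero]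
  obtain ⟨w, hw, hwz⟩ := h hψz
  refine ⟨apexMap k t w + apexHomotopy k top θ z, Submodule.add_mem _ ?_ ?_, ?_⟩
  · refine map_mem_supported k _ (fun s hs => ?_) hw
    obtain ⟨hs1, hs2⟩ := hs
    have hs3 : Cφ s ⊆ {c | (c = ∅ ∨ c ∈ orderComplex S) ∧ (c.card : ℤ) = i + 1 + 1} := by
      rintro c ⟨hc1, hc2, _⟩
      exact ⟨(hface c).2 hc2, by rw [hc1, hs2]⟩
    exact Finsupp.supported_mono hs3 (hφ s ⟨hs1, by omega⟩)
  · refine map_mem_supported k _ (fun c hc => ?_) hz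
    refine Finsupp.supported_mono ?_ (hD c ⟨(hface c).1 hc.1, hc.2.le⟩)
    rintro d ⟨hd1, hd2, _⟩
    refine ⟨(hface d).2 hd2, ?_⟩
    rw [hd1]; push_cast; rw [hc.2]
  -- With `φ`, `ψ` the two apex maps, `H` the homotopy and `ψ z = ∂ w`, one has `z = φ ψ z + ∂ H z =
  -- ∂ (φ w + H z)`.
  · have := apexHomotopy_spec k top θ hθ hθ0 z
    rw [hz0, map_zero, add_zero] at this
    rw [map_add, simplicialBoundary_apexMap, hwz, this]
    simp only [θ, LinearMap.comp_apply, add_sub_cancel]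

end Transfer

/-! ### Garland's method -/

section Garland

variable {α : Type*} [Fintype α] [DecidableEq α]

theorem sum_compl_eq_sum_erase {M : Type*} [AddCommMonoid M] (Φ : Finset α → α → M) :
    ∑ s : Finset α, ∑ v ∈ sᶜ, Φ s v = ∑ s : Finset α, ∑ v ∈ s, Φ (s.erase v) v := by
  rw [Finset.sum_sigma', Finset.sum_sigma']
  refine Finset.sum_bij' (fun p _ => ⟨insert p.2 p.1, p.2⟩) (fun p _ => ⟨p.1.erase p.2, p.2⟩)
    ?_ ?_ ?_ ?_ ?_
  · rintro ⟨s, v⟩ _; simp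
  · rintro ⟨s, v⟩ _; simp
  · rintro ⟨s, v⟩ h
    simp only [Finset.mem_sigma, Finset.mem_univ, Finset.mem_compl, true_and] at h
    simp [Finset.erase_insert h]
  · rintro ⟨s, v⟩ h
    simp only [Finset.mem_sigma, Finset.mem_univ, true_and] at h
    simp [Finset.insert_erase h]
  · rintro ⟨s, v⟩ h
    simp only [Finset.mem_sigma, Finset.mem_univ, Finset.mem_compl, true_and] at h
    simp [Finset.erase_insert h]

theorem simplicialBoundary_apply (k : Type*) [Field k] (c : Finset α →₀ k) (s : Finset α) :
    simplicialBoundary k c s = ∑ v ∈ sᶜ, vertexSign k v s * c (insert v s) := by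
  induction c using Finsupp.induction_linear with
  | zero => simp
  | add f g hf hg =>
    simp only [map_add, Finsupp.add_apply, hf, hg, mul_add, Finset.sum_add_distrib]
  | single t a =>
    rw [← mul_one a, ← smul_eq_mul, ← Finsupp.smul_single, map_smul, simplicialBoundary_single_one]
    simp only [Finsupp.smul_apply, Finsupp.finsetSum_apply, Finsupp.single_apply, smul_eq_mul]
    rw [Finset.mul_sum, ← Finset.sum_filter_add_sum_filter_not t (fun v => t.erase v = s),
      ← Finset.sum_filter_add_sum_filter_not sᶜ (fun v => t = insert v s),
      Finset.sum_eq_zero (s := t.filter (fun v => ¬ _)) (fun v hv => by simp [(Finset.mem_filter.1 hv).2]),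
      Finset.sum_eq_zero (s := sᶜ.filter (fun v => ¬ _))
        (fun v hv => by simp [(Finset.mem_filter.1 hv).2]), add_zero, add_zero]
    have hset : t.filter (fun v => t.erase v = s) = sᶜ.filter (fun v => t = insert v s) := by
      ext v
      simp only [Finset.mem_filter, Finset.mem_compl]
      constructor
      · rintro ⟨hv, rfl⟩
        exact ⟨Finset.notMem_erase v t, (Finset.insert_erase hv).symm⟩
      · rintro ⟨hv, rfl⟩
        exact ⟨Finset.mem_insert_self v s, Finset.erase_insert hv⟩
    rw [hset]
    refine Finset.sum_congr rfl fun v hv => ?_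
    obtain ⟨hvs, rfl⟩ := Finset.mem_filter.1 hv
    have hv := Finset.mem_compl.1 hvs
    rw [Finset.erase_insert hv, if_pos rfl, if_pos rfl, vertexSign_insert_self]
    ring

/-- The coboundary of a chain, restricted to the simplices satisfying `p`. -/
def restrictedCoboundary (p : Finset α → Prop) [DecidablePred p] :
    (Finset α →₀ ℚ) →ₗ[ℚ] (Finset α →₀ ℚ) where
  toFun f := Finsupp.equivFunOnFinite.symm fun r =>
    if p r then ∑ v ∈ r, vertexSign ℚ v r * f (r.erase v) else 0
  map_add' f g := by
    ext r
    by_cases h : p r <;> simp [h, mul_add, Finset.sum_add_distrib]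
  map_smul' a f := by
    ext r
    by_cases h : p r <;> simp [h, Finset.mul_sum, mul_left_comm]

theorem restrictedCoboundary_apply (p : Finset α → Prop) [DecidablePred p] (f : Finset α →₀ ℚ)
    (r : Finset α) : restrictedCoboundary p f r =
      if p r then ∑ v ∈ r, vertexSign ℚ v r * f (r.erase v) else 0 := rfl

/-- The coboundary is the adjoint of the boundary for the standard inner product on chains. -/
theorem sum_mul_simplicialBoundary (f c : Finset α →₀ ℚ) :
    ∑ s, f s * simplicialBoundary ℚ c s =
      ∑ r, (∑ v ∈ r, vertexSign ℚ v r * f (r.erase v)) * c r := by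
  simp only [simplicialBoundary_apply, Finset.mul_sum, Finset.sum_mul]
  rw [sum_compl_eq_sum_erase fun s v => f s * (vertexSign ℚ v s * c (insert v s))]
  refine Finset.sum_congr rfl fun r _ => Finset.sum_congr rfl fun v hv => ?_
  rw [Finset.insert_erase hv, vertexSign_erase_self]; ring

omit [Fintype α] in
theorem sq_sum_eq_diag_add (s : Finset α) (a : α → ℚ) :
    (∑ v ∈ s, a v) ^ 2 = ∑ v ∈ s, a v ^ 2 + ∑ v ∈ s, ∑ w ∈ s.erase v, a v * a w := by
  rw [sq, Finset.sum_mul_sum, ← Finset.sum_add_distrib]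
  refine Finset.sum_congr rfl fun v hv => ?_
  rw [← Finset.add_sum_erase s _ hv, sq]

/-- The square norm of the coboundary of a chain in terms of its localizations to links. -/
theorem sum_sq_restrictedCoboundary (p : Finset α → Prop) [DecidablePred p] (f : Finset α →₀ ℚ) :
    ∑ r, restrictedCoboundary p f r ^ 2 =
      ∑ s, f s ^ 2 * (sᶜ.filter fun v => p (insert v s)).card -
      ∑ t : Finset α, ∑ w ∈ tᶜ, ∑ v ∈ (insert w t)ᶜ, if p (insert v (insert w t)) then
        (vertexSign ℚ v t * f (insert v t)) * (vertexSign ℚ w t * f (insert w t)) else 0 := by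
  have h1 : ∀ r, restrictedCoboundary p f r ^ 2 =
      ∑ v ∈ r, (if p r then f (r.erase v) ^ 2 else 0) +
      ∑ v ∈ r, ∑ w ∈ r.erase v, (if p r then (vertexSign ℚ v r * f (r.erase v)) *
        (vertexSign ℚ w r * f (r.erase w)) else 0) := by
    intro r
    rw [restrictedCoboundary_apply]
    by_cases h : p r
    · simp only [if_pos h, sq_sum_eq_diag_add, mul_pow, vertexSign_sq, one_mul]
    · simp [h]
  simp only [h1]
  rw [Finset.sum_add_distrib, sub_eq_add_neg]
  congr 1
  -- Diagonal terms: each `s` is counted once for every admissible coface.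
  · trans ∑ s, ∑ v ∈ sᶜ, if p (insert v s) then f s ^ 2 else 0
    · rw [sum_compl_eq_sum_erase fun s v => if p (insert v s) then f s ^ 2 else 0]
      refine Finset.sum_congr rfl fun r _ => Finset.sum_congr rfl fun v hv => ?_
      rw [Finset.insert_erase hv]
    · refine Finset.sum_congr rfl fun s _ => ?_
      rw [← Finset.sum_filter, Finset.sum_const, nsmul_eq_mul, mul_comm]
  -- Off-diagonal terms: `r = t ∪ {v, w}`, and the two facets missing `v` and `w` are an edge in the
  -- link of `t`.
  · trans ∑ s, ∑ v ∈ sᶜ, ∑ w ∈ s, if p (insert v s) then (vertexSign ℚ v s * f s) *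
        (vertexSign ℚ w (insert v s) * f ((insert v s).erase w)) else 0
    · rw [sum_compl_eq_sum_erase fun s v => ∑ w ∈ s, if p (insert v s) then
        (vertexSign ℚ v s * f s) *
        (vertexSign ℚ w (insert v s) * f ((insert v s).erase w)) else 0]
      refine Finset.sum_congr rfl fun r _ => Finset.sum_congr rfl fun v hv => ?_
      rw [Finset.insert_erase hv, vertexSign_erase_self]
    · simp only [← Finset.sum_neg_distrib]
      rw [sum_compl_eq_sum_erase fun t w => ∑ v ∈ (insert w t)ᶜ,
        -if p (insert v (insert w t)) then
        (vertexSign ℚ v t * f (insert v t)) * (vertexSign ℚ w t * f (insert w t)) else 0]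
      refine Finset.sum_congr rfl fun s _ => ?_
      rw [Finset.sum_comm]
      refine Finset.sum_congr rfl fun w hw => ?_
      rw [Finset.insert_erase hw]
      refine Finset.sum_congr rfl fun v hv => ?_
      rw [Finset.mem_compl] at hv
      have hvw : v ≠ w := fun h => hv (h ▸ hw)
      have hv' : v ∉ s.erase w := fun h => hv (Finset.mem_of_mem_erase h)
      have h2 := vertexSign_swap ℚ hvw hv' (Finset.notMem_erase w s)
      rw [Finset.insert_erase hw] at h2
      rw [Finset.erase_insert_of_ne hvw, ← vertexSign_erase_self ℚ w (insert v s),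
        Finset.erase_insert_of_ne hvw]
      split_ifs
      · linear_combination (f s * f (insert v (s.erase w))) * h2
      · simp

/-- **Garland's method**: if the adjacency forms of the links of the `(m - 1)`-simplices are bounded
by `B` on functions of sum zero, and every `m`-simplex lies in at least `D > (m + 1) B` simplices of
dimension `m + 1`, then the rational homology in degree `m` vanishes. -/
theorem cycles_le_boundaries_of_garland (X : PreAbstractSimplicialComplex α) (m : ℕ) (B D : ℚ)
    (hB : ∀ t : Finset α, (t = ∅ ∨ t ∈ X) → t.card = m → ∀ f : α → ℚ,
      (∀ v, ¬ (v ∉ t ∧ insert v t ∈ X) → f v = 0) → ∑ v, f v = 0 →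
      ∑ w, ∑ v, (open Classical in if v ≠ w ∧ insert v (insert w t) ∈ X then f v * f w else 0) ≤
        B * ∑ v, f v ^ 2)
    (hD : ∀ s ∈ X, s.card = m + 1 →
      D ≤ (open Classical in (sᶜ.filter fun v => insert v s ∈ X).card : ℚ))
    (h : (m + 1) * B < D) : simplicialCycles ℚ X m ≤ simplicialBoundaries ℚ X m := by
  classical
  let p : Finset α → Prop := fun s => s ∈ X ∧ s.card = m + 2
  have hface : ∀ {s : Finset α} {v}, insert v s ∈ X → s = ∅ ∨ s ∈ X := by
    intro s v hs
    rcases s.eq_empty_or_nonempty with h | h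
    · exact Or.inl h
    · exact Or.inr ((X.isRelLowerSet_faces hs).2 (Finset.subset_insert v s) h)
  have key : ∀ f ∈ simplicialCycles ℚ X m,
      (D - (m + 1) * B) * ∑ s, f s ^ 2 ≤ ∑ r, restrictedCoboundary p f r ^ 2 := by
    rintro f ⟨hf, hf0⟩
    have hf0 := LinearMap.mem_ker.1 hf0
    have hfX : ∀ s, f s ≠ 0 → s ∈ X ∧ s.card = m + 1 := by
      intro s hs
      obtain ⟨h1, h2⟩ := (Finsupp.mem_supported _ _).1 hf (Finsupp.mem_support_iff.2 hs)
      have h2 : s.card = m + 1 := by exact_mod_cast h2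
      refine ⟨h1.resolve_left fun h0 => ?_, h2⟩
      rw [h0] at h2; simp at h2
    rw [sum_sq_restrictedCoboundary, sub_mul]
    refine sub_le_sub ?_ ?_
    · rw [Finset.mul_sum]
      refine Finset.sum_le_sum fun s _ => ?_
      by_cases hs : f s = 0
      · simp [hs]
      · obtain ⟨h1, h2⟩ := hfX s hs
        rw [mul_comm]
        refine mul_le_mul_of_nonneg_left ((hD s h1 h2).trans (le_of_eq ?_)) (sq_nonneg _)
        congr 2
        refine Finset.filter_congr fun v hv => ?_
        simp only [p, Finset.card_insert_of_notMem (Finset.mem_compl.1 hv), h2, and_true]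
    -- Each simplex in the support of `f` has `m + 1` facets; this is the factor in front of `B`.
    · have hnorm : ∑ t : Finset α, ∑ v ∈ tᶜ, f (insert v t) ^ 2 = (m + 1) * ∑ s, f s ^ 2 := by
        rw [sum_compl_eq_sum_erase fun t v => f (insert v t) ^ 2, Finset.mul_sum]
        refine Finset.sum_congr rfl fun s _ => ?_
        rw [Finset.sum_congr rfl fun v hv => by rw [Finset.insert_erase hv], Finset.sum_const,
          nsmul_eq_mul]
        by_cases hs : f s = 0
        · simp [hs]
        · rw [(hfX s hs).2]; push_cast; rfl
      rw [mul_comm _ B, mul_assoc, ← hnorm, Finset.mul_sum]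
      refine Finset.sum_le_sum fun t _ => ?_
      by_cases ht : (t = ∅ ∨ t ∈ X) ∧ t.card = m
      -- The localization of `f` to the link of `t`; its total sum is the coefficient of `t` in `∂
      -- f`, hence zero.
      · let g : α → ℚ := fun v => if v ∈ t then 0 else vertexSign ℚ v t * f (insert v t)
        have hg : ∀ v, ¬ (v ∉ t ∧ insert v t ∈ X) → g v = 0 := by
          intro v hv
          by_cases hvt : v ∈ t
          · simp [g, hvt]
          · have : f (insert v t) = 0 := by
              by_contra h0
              exact hv ⟨hvt, (hfX _ h0).1⟩
            simp [g, this]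
        have hgc : ∀ v ∈ tᶜ, g v = vertexSign ℚ v t * f (insert v t) := fun v hv =>
          if_neg (Finset.mem_compl.1 hv)
        have hsum : ∀ F : α → ℚ, (∀ v ∈ t, F v = 0) → ∑ v ∈ tᶜ, F v = ∑ v, F v := by
          intro F hF
          rw [← Finset.sum_compl_add_sum t F, Finset.sum_eq_zero hF, add_zero]
        have hg0 : ∑ v, g v = 0 := by
          rw [← hsum g fun v hv => if_pos hv, Finset.sum_congr rfl hgc,
            ← simplicialBoundary_apply, hf0, Finsupp.zero_apply]
        have hgs : ∑ v ∈ tᶜ, f (insert v t) ^ 2 = ∑ v, g v ^ 2 := by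
          rw [← hsum _ fun v hv => by simp [g, hv]]
          refine Finset.sum_congr rfl fun v hv => ?_
          rw [hgc v hv, mul_pow, vertexSign_sq, one_mul]
        rw [hgs]
        refine le_trans (le_of_eq ?_) (hB t ht.1 ht.2 g hg hg0)
        rw [← hsum _ fun w hw => Finset.sum_eq_zero fun v _ => by simp [g, hw]]
        refine Finset.sum_congr rfl fun w hw => ?_
        rw [← Finset.sum_compl_add_sum (insert w t), Finset.sum_eq_zero (s := insert w t), add_zero]
        · refine Finset.sum_congr rfl fun v hv => ?_
          simp only [Finset.mem_compl, Finset.mem_insert, not_or] at hv hw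
          have hcard : (insert v (insert w t)).card = m + 2 := by
            rw [Finset.card_insert_of_notMem (by simp [hv]), Finset.card_insert_of_notMem hw, ht.2]
          simp [p, hcard, hv.1, g, hv.2, hw]
        · intro v hv
          rcases Finset.mem_insert.1 hv with rfl | hv
          · simp
          · simp [g, hv]
      · have hz : ∀ v ∈ tᶜ, f (insert v t) = 0 := by
          intro v hv
          by_contra h0
          obtain ⟨h1, h2⟩ := hfX _ h0
          rw [Finset.card_insert_of_notMem (Finset.mem_compl.1 hv)] at h2
          exact ht ⟨hface h1, by omega⟩
        rw [Finset.sum_eq_zero, Finset.sum_eq_zero, mul_zero]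
        · intro v hv; rw [hz v hv]; norm_num
        · intro w hw
          refine Finset.sum_eq_zero fun v _ => ?_
          rw [hz w hw]; simp
  have hcob : ∀ f, restrictedCoboundary p f ∈ simplicialChains ℚ X (m + 1) := by
    intro f
    refine (Finsupp.mem_supported _ _).2 fun s hs => ?_
    have hs : restrictedCoboundary p f s ≠ 0 := Finsupp.mem_support_iff.1 hs
    rw [restrictedCoboundary_apply] at hs
    have hps : p s := by by_contra h0; exact hs (if_neg h0)
    exact ⟨Or.inr hps.1, by rw [hps.2]; push_cast; ring⟩
  have hbd : ∀ f, simplicialBoundary ℚ (restrictedCoboundary p f) ∈ simplicialBoundaries ℚ X m :=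
    fun f => ⟨_, hcob f, rfl⟩
  -- If `∂ δ f = 0`, then `‖δ f‖² = ⟨f, ∂ δ f⟩ = 0` by adjointness, and `key` forces `f = 0`.
  have hinj : ∀ f ∈ simplicialCycles ℚ X m,
      simplicialBoundary ℚ (restrictedCoboundary p f) = 0 → f = 0 := by
    intro f hf h0
    have h1 : ∑ r, restrictedCoboundary p f r ^ 2 = 0 := by
      have := sum_mul_simplicialBoundary f (restrictedCoboundary p f)
      rw [h0] at this
      simp only [Finsupp.zero_apply, mul_zero, Finset.sum_const_zero] at this
      rw [this]
      refine Finset.sum_congr rfl fun r _ => ?_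
      rw [restrictedCoboundary_apply]
      by_cases hr : p r <;> simp [hr, sq]
    have h2 := key f hf
    rw [h1] at h2
    have h3 : ∑ s, f s ^ 2 ≤ 0 := by
      by_contra h4
      exact absurd h2 (not_le.2 (mul_pos (sub_pos.2 h) (not_le.1 h4)))
    ext s
    have h4 := (Finset.sum_eq_zero_iff_of_nonneg fun s _ => sq_nonneg (f s)).1
      (le_antisymm h3 (Finset.sum_nonneg fun s _ => sq_nonneg (f s))) s (Finset.mem_univ s)
    simpa using h4
  -- An injective endomorphism of a finite-dimensional space is surjective, so every cycle has the
  -- form `∂ δ f`.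
  let T : simplicialCycles ℚ X m →ₗ[ℚ] simplicialCycles ℚ X m :=
    ((simplicialBoundary ℚ ∘ₗ restrictedCoboundary p) ∘ₗ (simplicialCycles ℚ X m).subtype).codRestrict
      _ fun f => simplicialBoundaries_le_cycles ℚ X m (hbd f)
  have hT : Function.Injective T := by
    rw [← LinearMap.ker_eq_bot, LinearMap.ker_eq_bot']
    intro f hf
    exact Subtype.ext (hinj f f.2 (congrArg Subtype.val hf))
  intro z hz
  obtain ⟨f, hf⟩ := LinearMap.injective_iff_surjective.1 hT ⟨z, hz⟩
  have : simplicialBoundary ℚ (restrictedCoboundary p f) = z := congrArg Subtype.val hf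
  rw [← this]
  exact hbd f

end Garland

/-! ### Counting in unitary spaces -/

section NormEquation

variable {K : Type*} [Field K] [Finite K]

/-- An involution of order `2` of a field with `q ^ 2` elements is `x ↦ x ^ q`. -/
theorem involution_eq_pow {q : ℕ} (hq : Nat.card K = q ^ 2) (τ : K →+* K)
    (hτ : ∀ x, τ (τ x) = x) (hne : τ ≠ RingHom.id K) (x : K) : τ x = x ^ q := by
  obtain ⟨p, hp⟩ := CharP.exists K
  have hp' : Fact p.Prime := ⟨(CharP.char_is_prime_or_zero K p).resolve_right
    (CharP.char_ne_zero_of_finite K p)⟩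
  let _ : Algebra (ZMod p) K := ZMod.algebra K p
  let _ : Fintype K := Fintype.ofFinite K
  have hmod : Module.Finite (ZMod p) K := Module.Finite.of_finite
  let σ : K →ₐ[ZMod p] K := AlgHom.mk τ fun r => by
    obtain ⟨r, rfl⟩ := ZMod.intCast_surjective r
    simp
  -- Every automorphism is a power `j < [K : F_p]` of Frobenius. Order two forces `[K : F_p] = 2j`,
  -- whence `q = p^j`.
  obtain ⟨j, hj⟩ := (FiniteField.bijective_frobeniusAlgHom_pow (ZMod p) K).2 σ
  have hj : FiniteField.frobeniusAlgHom (ZMod p) K ^ (j : ℕ) = σ := hj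
  have hord := FiniteField.orderOf_frobeniusAlgHom (ZMod p) K
  have hσ2 : σ ^ 2 = 1 := by
    ext y
    rw [sq]
    exact hτ y
  have hσ1 : σ ≠ 1 := fun h => hne (RingHom.ext fun y => DFunLike.congr_fun h y)
  have hj0 : (j : ℕ) ≠ 0 := by
    intro h0; rw [h0, pow_zero] at hj; exact hσ1 hj.symm
  have hdvd : Module.finrank (ZMod p) K ∣ j * 2 := by
    have h0 : orderOf (FiniteField.frobeniusAlgHom (ZMod p) K) ∣ j * 2 :=
      orderOf_dvd_of_pow_eq_one (by rw [pow_mul, hj, hσ2])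
    rwa [hord] at h0
  have hjlt : (j : ℕ) < Module.finrank (ZMod p) K := j.2
  have h2j : Module.finrank (ZMod p) K = j * 2 := by
    obtain ⟨c, hc⟩ := hdvd
    have : c = 1 := by
      rcases c with _ | _ | c
      · omega
      · rfl
      · exfalso; nlinarith
    rw [hc, this, mul_one]
  have hqp : q = p ^ (j : ℕ) := by
    have h1 : Nat.card K = p ^ Module.finrank (ZMod p) K := by
      rw [Module.natCard_eq_pow_finrank (K := ZMod p), Nat.card_zmod]
    rw [hq, h2j, pow_mul] at h1
    exact Nat.pow_left_injective two_ne_zero h1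
  have h3 : τ x = (FiniteField.frobeniusAlgHom (ZMod p) K ^ (j : ℕ)) x := by
    rw [hj]; rfl
  rw [h3, AlgHom.coe_pow, FiniteField.coe_frobeniusAlgHom, pow_iterate, hqp, ZMod.card]

/-- The norm equation is `a^(q+1) = c`, a polynomial equation of degree `q + 1`. -/
theorem card_norm_eq_le [Fintype K] [DecidableEq K] {q : ℕ} (hq : Nat.card K = q ^ 2)
    (τ : K →+* K) (hτ : ∀ x, τ (τ x) = x) (hne : τ ≠ RingHom.id K) (c : K) :
    (Finset.univ.filter fun a : K => a * τ a = c).card ≤ q + 1 := by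
  refine le_trans (Finset.card_le_card (t := (Polynomial.nthRoots (q + 1) c).toFinset) ?_)
    ((Multiset.toFinset_card_le _).trans (Polynomial.card_nthRoots _ _))
  intro a ha
  rw [Finset.mem_filter] at ha
  rw [Multiset.mem_toFinset, Polynomial.mem_nthRoots (Nat.succ_pos q), pow_succ', ← ha.2,
    involution_eq_pow hq τ hτ hne]

end NormEquation

/-! ### Perpendicular subspaces and isotropic vectors -/

section Unitary

variable {K : Type*} [Field K] {V : Type*} [AddCommGroup V] [Module K V] {τ : K →+* K}
  {Ψ : V →ₗ[K] V →ₛₗ[τ] K}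

theorem IsUnitarySpace.eq_zero_symm (hΨ : IsUnitarySpace τ Ψ) {v w : V} (h : Ψ v w = 0) :
    Ψ w v = 0 := by
  rw [hΨ.hermitian, h, map_zero]

/-- The vectors orthogonal to `u`. -/
def vectorPerp (Ψ : V →ₗ[K] V →ₛₗ[τ] K) (u : V) : Submodule K V := LinearMap.ker (Ψ.flip u)

theorem mem_vectorPerp {u w : V} : w ∈ vectorPerp Ψ u ↔ Ψ w u = 0 := by
  rw [vectorPerp, LinearMap.mem_ker, LinearMap.flip_apply]

theorem finrank_inf_vectorPerp [FiniteDimensional K V] (W : Submodule K V) {u w : V} (hw : w ∈ W)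
    (h : Ψ w u ≠ 0) :
    Module.finrank K ↥(W ⊓ vectorPerp Ψ u) + 1 = Module.finrank K W := by
  let L : W →ₗ[K] K := (Ψ.flip u) ∘ₗ W.subtype
  have hL : Function.Surjective L := by
    refine LinearMap.surjective fun h0 => h ?_
    exact LinearMap.congr_fun h0 ⟨w, hw⟩
  have h1 := LinearMap.finrank_range_add_finrank_ker L
  rw [LinearMap.range_eq_top.2 hL, finrank_top, Module.finrank_self] at h1
  have h2 : (LinearMap.ker L).map W.subtype = W ⊓ vectorPerp Ψ u := by
    ext x
    simp only [Submodule.mem_map, LinearMap.mem_ker, Submodule.mem_inf, mem_vectorPerp]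
    constructor
    · rintro ⟨y, hy, rfl⟩; exact ⟨y.2, hy⟩
    · rintro ⟨hx, hx'⟩; exact ⟨⟨x, hx⟩, hx', rfl⟩
  rw [← h2, Submodule.finrank_map_subtype_eq, ← h1, add_comm]

theorem IsNondegenerateSubspace.inf_vectorPerp {W : Submodule K V}
    (hW : IsNondegenerateSubspace Ψ W) {u : V} (hu : u ∈ W) (h : Ψ u u ≠ 0) :
    IsNondegenerateSubspace Ψ (W ⊓ vectorPerp Ψ u) := by
  rintro v ⟨hv, hvu⟩ hv0
  rw [SetLike.mem_coe, mem_vectorPerp] at hvu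
  refine hW v hv fun w hw => ?_
  have hd : w - (Ψ w u / Ψ u u) • u ∈ W ⊓ vectorPerp Ψ u := by
    refine ⟨W.sub_mem hw (W.smul_mem _ hu), ?_⟩
    rw [SetLike.mem_coe, mem_vectorPerp, map_sub, map_smul, LinearMap.sub_apply,
      LinearMap.smul_apply, smul_eq_mul, div_mul_cancel₀ _ h, sub_self]
  have := hv0 _ hd
  rwa [map_sub, LinearMap.map_smulₛₗ, hvu, smul_zero, sub_zero] at this

/-- If all vectors are isotropic, polarizing at a pair with `Ψ v w ≠ 0` gives `x + τ x = 0` for all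
`x`. Taking `x = 1` shows that the characteristic is two, so `τ` is the identity. -/
theorem IsNondegenerateSubspace.exists_anisotropic (hΨ : IsUnitarySpace τ Ψ) {W : Submodule K V}
    (hW : IsNondegenerateSubspace Ψ W) (h : W ≠ ⊥) : ∃ e ∈ W, Ψ e e ≠ 0 := by
  by_contra! hc
  obtain ⟨v, hv, hv0⟩ := W.ne_bot_iff.1 h
  refine hv0 (hW v hv fun w hw => ?_)
  by_contra hvw
  have key : ∀ x : K, x + τ x = 0 := by
    intro x
    have h1 := hc ((x / Ψ v w) • v + w) (W.add_mem (W.smul_mem _ hv) hw)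
    have h2 : Ψ w v = τ (Ψ v w) := hΨ.hermitian w v
    have h3 : τ (Ψ v w) ≠ 0 := fun h0 => hvw (by rw [← hΨ.involutive (Ψ v w), h0, map_zero])
    simp only [map_add, map_smul, LinearMap.add_apply, LinearMap.smul_apply,
      LinearMap.map_smulₛₗ, hc v hv, hc w hw, h2, smul_eq_mul, map_div₀, mul_zero, zero_add,
      add_zero] at h1
    rwa [div_mul_cancel₀ _ hvw, div_mul_cancel₀ _ h3, add_comm] at h1
  refine hΨ.ne_id (RingHom.ext fun x => ?_)
  have h1 := key 1
  rw [map_one] at h1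
  have h2 := key x
  rw [RingHom.id_apply]
  linear_combination h2 - x * h1

variable [Finite K] [FiniteDimensional K V]

omit [Finite K] in
theorem card_filter_mem [Fintype V] {q : ℕ} (hq : Nat.card K = q ^ 2) (W : Submodule K V)
    (p : V → Prop) [DecidablePred p] (hp : ∀ v, p v ↔ v ∈ W) :
    (Finset.univ.filter p).card = (q ^ 2) ^ Module.finrank K W := by
  rw [← hq, ← Module.natCard_eq_pow_finrank, ← Fintype.card_subtype, ← Nat.card_eq_fintype_card]
  exact Nat.card_congr (Equiv.subtypeEquivRight hp)

-- Project along an anisotropic `e` onto `e^⊥ ∩ W`, which has `q^(2d)` vectors. An isotropic vector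
-- `w + a e` over `w` satisfies `a τ(a) = -Ψ w w / Ψ e e`, so each fibre has at most `q + 1` of
-- them.
open Classical in
theorem card_isotropic_le [Fintype V] (hΨ : IsUnitarySpace τ Ψ) {q : ℕ} (hq : Nat.card K = q ^ 2)
    {W : Submodule K V} (hW : IsNondegenerateSubspace Ψ W) {d : ℕ}
    (hd : Module.finrank K W = d + 1) :
    (Finset.univ.filter fun v : V => v ∈ W ∧ Ψ v v = 0).card ≤ (q + 1) * (q ^ 2) ^ d := by
  let _ : Fintype K := Fintype.ofFinite K
  obtain ⟨e, he, hee⟩ := hW.exists_anisotropic hΨ (by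
    rintro rfl; rw [finrank_bot] at hd; omega)
  have hfin := finrank_inf_vectorPerp W he hee
  have hcard := card_filter_mem hq (W ⊓ vectorPerp Ψ e) (fun v => v ∈ W ⊓ vectorPerp Ψ e)
    fun v => Iff.rfl
  rw [show Module.finrank K ↥(W ⊓ vectorPerp Ψ e) = d by omega] at hcard
  rw [← hcard]
  refine Finset.card_le_mul_card_image_of_maps_to (f := fun v => v - (Ψ v e / Ψ e e) • e) ?_ _ ?_
  · intro v hv
    simp only [Finset.mem_filter, Finset.mem_univ, true_and] at hv ⊢
    refine ⟨W.sub_mem hv.1 (W.smul_mem _ he), ?_⟩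
    rw [SetLike.mem_coe, mem_vectorPerp, map_sub, map_smul, LinearMap.sub_apply,
      LinearMap.smul_apply, smul_eq_mul, div_mul_cancel₀ _ hee, sub_self]
  · intro w hw
    simp only [Finset.mem_filter, Finset.mem_univ, true_and, Submodule.mem_inf,
      mem_vectorPerp] at hw
    refine le_trans (Finset.card_le_card_of_injOn (fun v => Ψ v e / Ψ e e) ?_ ?_)
      (card_norm_eq_le hq τ hΨ.involutive hΨ.ne_id (-Ψ w w / Ψ e e))
    · intro v hv
      simp only [Finset.coe_filter, Finset.mem_filter, Finset.mem_univ, true_and,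
        Set.mem_ofPred_eq] at hv ⊢
      obtain ⟨⟨_, hv0⟩, hvw⟩ := hv
      set a := Ψ v e / Ψ e e
      have hva : v = w + a • e := by rw [← hvw, sub_add_cancel]
      rw [hva] at hv0
      simp only [map_add, map_smul, LinearMap.add_apply, LinearMap.smul_apply,
        LinearMap.map_smulₛₗ, hw.2, hΨ.eq_zero_symm hw.2, smul_eq_mul, mul_zero, add_zero,
        zero_add] at hv0
      rw [eq_div_iff hee]
      linear_combination hv0
    · intro v hv v' hv' h
      simp only [Finset.coe_filter, Finset.mem_filter, Finset.mem_univ, true_and,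
        Set.mem_ofPred_eq] at hv hv' h
      rw [← sub_add_cancel v ((Ψ v e / Ψ e e) • e), hv.2, h, ← hv'.2, sub_add_cancel]

end Unitary

/-! ### Non-degenerate lines -/

section Lines

variable {K : Type*} [Field K] {V : Type*} [AddCommGroup V] [Module K V] {τ : K →+* K}
  {Ψ : V →ₗ[K] V →ₛₗ[τ] K}

namespace NondegenerateLine

theorem exists_gen (l : NondegenerateLine Ψ) : ∃ v, l.1 = K ∙ v ∧ Ψ v v ≠ 0 := by
  obtain ⟨⟨v, hv⟩, hv0, hspan⟩ := finrank_eq_one_iff'.1 l.2.1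
  have hspan' : ∀ w ∈ l.1, ∃ c : K, c • v = w := fun w hw => by
    obtain ⟨c, hc⟩ := hspan ⟨w, hw⟩
    exact ⟨c, congrArg Subtype.val hc⟩
  refine ⟨v, le_antisymm (fun w hw => Submodule.mem_span_singleton.2 (hspan' w hw))
    ((Submodule.span_singleton_le_iff_mem v _).2 hv), fun h0 => hv0 (Subtype.ext ?_)⟩
  refine l.2.2 v hv fun w hw => ?_
  obtain ⟨c, rfl⟩ := hspan' w hw
  rw [LinearMap.map_smulₛₗ, h0, smul_zero]

/-- A vector spanning the line `l`. -/
def gen (l : NondegenerateLine Ψ) : V := l.exists_gen.choose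

theorem eq_span_gen (l : NondegenerateLine Ψ) : l.1 = K ∙ l.gen := l.exists_gen.choose_spec.1

theorem gen_anisotropic (l : NondegenerateLine Ψ) : Ψ l.gen l.gen ≠ 0 :=
  l.exists_gen.choose_spec.2

theorem gen_ne_zero (l : NondegenerateLine Ψ) : l.gen ≠ 0 := by
  intro h
  apply l.gen_anisotropic
  rw [h, map_zero]

/-- The line spanned by an anisotropic vector. -/
def ofVector (v : V) (hv : Ψ v v ≠ 0) : NondegenerateLine Ψ :=
  ⟨K ∙ v, finrank_span_singleton (by rintro rfl; simp at hv), by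
    intro w hw h
    obtain ⟨a, rfl⟩ := Submodule.mem_span_singleton.1 hw
    have := h v (Submodule.mem_span_singleton_self v)
    rw [map_smul, LinearMap.smul_apply, smul_eq_mul] at this
    rw [(mul_eq_zero.1 this).resolve_right hv, zero_smul]⟩

theorem gen_mem_of_ofVector {v : V} (hv : Ψ v v ≠ 0) {W : Submodule K V} (h : v ∈ W) :
    (ofVector v hv).gen ∈ W := by
  have h1 : K ∙ (ofVector v hv).gen = K ∙ v := (eq_span_gen (ofVector v hv)).symm
  have h2 : K ∙ (ofVector v hv).gen ≤ W := by
    rw [h1]; exact (Submodule.span_singleton_le_iff_mem v W).2 h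
  exact (Submodule.span_singleton_le_iff_mem _ W).1 h2

theorem eq_of_smul_gen_eq {l l' : NondegenerateLine Ψ} {a b : K} (ha : a ≠ 0) (hb : b ≠ 0)
    (h : a • l.gen = b • l'.gen) : l = l' := by
  refine Subtype.ext ?_
  rw [eq_span_gen, eq_span_gen, ← Submodule.span_singleton_smul_eq ha.isUnit, h,
    Submodule.span_singleton_smul_eq hb.isUnit]

theorem adj_iff (hΨ : IsUnitarySpace τ Ψ) (l l' : NondegenerateLine Ψ) :
    (orthogonalityGraph Ψ).Adj l l' ↔ Ψ l.gen l'.gen = 0 := by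
  have key : ∀ l l' : NondegenerateLine Ψ,
      (∀ v ∈ l.1, ∀ w ∈ l'.1, Ψ v w = 0) ↔ Ψ l.gen l'.gen = 0 := by
    intro l l'
    rw [eq_span_gen l, eq_span_gen l']
    constructor
    · exact fun h => h _ (Submodule.mem_span_singleton_self _) _
        (Submodule.mem_span_singleton_self _)
    · intro h v hv w hw
      obtain ⟨a, rfl⟩ := Submodule.mem_span_singleton.1 hv
      obtain ⟨b, rfl⟩ := Submodule.mem_span_singleton.1 hw
      rw [LinearMap.map_smul, LinearMap.smul_apply, LinearMap.map_smulₛₗ, h, smul_zero, smul_zero]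
  rw [orthogonalityGraph, SimpleGraph.fromRel_adj, key, key]
  constructor
  · rintro ⟨_, h | h⟩
    exacts [h, hΨ.eq_zero_symm h]
  · intro h
    refine ⟨?_, Or.inl h⟩
    rintro rfl
    exact gen_anisotropic l h

end NondegenerateLine

/-- The subspace of vectors orthogonal to all lines in `s`. -/
def framePerp (s : Finset (NondegenerateLine Ψ)) : Submodule K V :=
  ⨅ l ∈ s, vectorPerp Ψ l.gen

theorem mem_framePerp {s : Finset (NondegenerateLine Ψ)} {w : V} :
    w ∈ framePerp s ↔ ∀ l ∈ s, Ψ w l.gen = 0 := by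
  simp only [framePerp, Submodule.mem_iInf, mem_vectorPerp]

theorem framePerp_insert [DecidableEq (NondegenerateLine Ψ)] (l : NondegenerateLine Ψ)
    (s : Finset (NondegenerateLine Ψ)) :
    framePerp (insert l s) = framePerp s ⊓ vectorPerp Ψ l.gen := by
  ext w
  simp [mem_framePerp, mem_vectorPerp, and_comm]

theorem gen_mem_framePerp_iff (hΨ : IsUnitarySpace τ Ψ) (l : NondegenerateLine Ψ)
    (s : Finset (NondegenerateLine Ψ)) :
    l.gen ∈ framePerp s ↔ ∀ l' ∈ s, (orthogonalityGraph Ψ).Adj l l' := by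
  simp only [mem_framePerp, NondegenerateLine.adj_iff hΨ]

/-- Lines are split off one at a time: each is anisotropic and lies in the perpendicular space of
the previous ones. -/
theorem framePerp_spec [FiniteDimensional K V] (hΨ : IsUnitarySpace τ Ψ)
    (s : Finset (NondegenerateLine Ψ)) (hs : (orthogonalityGraph Ψ).IsClique (s : Set _)) :
    IsNondegenerateSubspace Ψ (framePerp s) ∧
      Module.finrank K (framePerp s) + s.card = Module.finrank K V := by
  classical
  induction s using Finset.induction_on with
  | empty =>
    have : framePerp (∅ : Finset (NondegenerateLine Ψ)) = ⊤ := by simp [framePerp]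
    rw [this, finrank_top]
    exact ⟨fun v _ h => hΨ.nondegenerate v fun w => h w trivial, rfl⟩
  | insert l s hl ih =>
    rw [Finset.coe_insert, SimpleGraph.isClique_insert_of_notMem (by simpa using hl)] at hs
    obtain ⟨h1, h2⟩ := ih hs.1
    have hmem : l.gen ∈ framePerp s := (gen_mem_framePerp_iff hΨ l s).2 fun l' h' => hs.2 l' h'
    rw [framePerp_insert, Finset.card_insert_of_notMem hl, ← h2,
      ← finrank_inf_vectorPerp _ hmem l.gen_anisotropic]
    exact ⟨h1.inf_vectorPerp hmem l.gen_anisotropic, by ring⟩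

variable [Finite K] [FiniteDimensional K V] [Fintype V] [Fintype (NondegenerateLine Ψ)]

-- A line contains at most `q² - 1` anisotropic vectors, and the remaining vectors of `W` are
-- isotropic. This bounds from below the degree in Garland's method.
open Classical in
theorem le_card_lines_mul (hΨ : IsUnitarySpace τ Ψ) {q : ℕ} (hq : Nat.card K = q ^ 2)
    {W : Submodule K V} (hW : IsNondegenerateSubspace Ψ W) {d : ℕ}
    (hd : Module.finrank K W = d + 1) :
    (q ^ 2) ^ (d + 1) ≤ (q ^ 2 - 1) *
      (Finset.univ.filter fun l : NondegenerateLine Ψ => l.gen ∈ W).card +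
      (q + 1) * (q ^ 2) ^ d := by
  let _ : Fintype K := Fintype.ofFinite K
  have h1 := card_filter_mem hq W (fun v => v ∈ W) fun v => Iff.rfl
  rw [hd, ← Finset.card_filter_add_card_filter_not (fun v => ¬ Ψ v v = 0), Finset.filter_filter,
    Finset.filter_filter] at h1
  simp only [not_not] at h1
  rw [← h1]
  refine add_le_add ?_ (card_isotropic_le hΨ hq hW hd)
  -- The value `none` is a default for isotropic vectors, which are excluded from the set being
  -- counted.
  refine Finset.card_le_mul_card_image_of_maps_to
    (f := fun v => if h : Ψ v v ≠ 0 then some (NondegenerateLine.ofVector v h) else none)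
    (t := (Finset.univ.filter fun l : NondegenerateLine Ψ => l.gen ∈ W).image some) ?_ _ ?_
    |>.trans (Nat.mul_le_mul_left _ Finset.card_image_le)
  · intro v hv
    simp only [Finset.mem_filter, Finset.mem_univ, true_and] at hv
    simp only [ne_eq, hv.2, not_false_eq_true, dif_pos]
    exact Finset.mem_image_of_mem _ (Finset.mem_filter.2
      ⟨Finset.mem_univ _, NondegenerateLine.gen_mem_of_ofVector hv.2 hv.1⟩)
  · intro l hl
    obtain ⟨l, -, rfl⟩ := Finset.mem_image.1 hl
    have h2 : q ^ 2 - 1 = ((Finset.univ.filter fun a : K => a ≠ 0).image fun a => a • l.gen).card := by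
      rw [Finset.card_image_of_injective _ (smul_left_injective K l.gen_ne_zero),
        Finset.filter_ne', Finset.card_erase_of_mem (Finset.mem_univ _), Finset.card_univ,
        ← Nat.card_eq_fintype_card, hq]
    rw [h2]
    refine Finset.card_le_card fun v hv => ?_
    simp only [Finset.mem_filter, Finset.mem_univ, true_and] at hv
    obtain ⟨⟨_, hv0⟩, hvl⟩ := hv
    rw [dif_pos hv0, Option.some.injEq] at hvl
    have h3 : v ∈ K ∙ l.gen := by
      rw [← l.eq_span_gen, ← hvl]; exact Submodule.mem_span_singleton_self v
    obtain ⟨a, rfl⟩ := Submodule.mem_span_singleton.1 h3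
    refine Finset.mem_image.2 ⟨a, Finset.mem_filter.2 ⟨Finset.mem_univ _, ?_⟩, rfl⟩
    rintro rfl
    simp at hv0

-- For distinct lines the projection of `v` to `u^⊥` is a nonzero vector of a non-degenerate space,
-- so the second condition lowers the dimension again. The count therefore depends only on whether
-- `u = v`, even when the plane they span is degenerate.
omit [Finite K] [Fintype (NondegenerateLine Ψ)] in
open Classical in
theorem card_common_perp (hΨ : IsUnitarySpace τ Ψ) {q : ℕ} (hq : Nat.card K = q ^ 2)
    {W : Submodule K V} (hW : IsNondegenerateSubspace Ψ W) {m : ℕ}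
    (hd : Module.finrank K W = m + 2) {u v : NondegenerateLine Ψ} (hu : u.gen ∈ W)
    (hv : v.gen ∈ W) :
    (Finset.univ.filter fun w : V => w ∈ W ∧ Ψ w u.gen = 0 ∧ Ψ w v.gen = 0).card =
      if u = v then (q ^ 2) ^ (m + 1) else (q ^ 2) ^ m := by
  have h1 := finrank_inf_vectorPerp W hu u.gen_anisotropic
  split_ifs with huv
  · subst huv
    rw [card_filter_mem hq (W ⊓ vectorPerp Ψ u.gen)]
    · congr 1; omega
    · intro w; simp [mem_vectorPerp]
  · have hW' := hW.inf_vectorPerp hu u.gen_anisotropic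
    set c := Ψ v.gen u.gen / Ψ u.gen u.gen with hc
    have hmem : v.gen - c • u.gen ∈ W ⊓ vectorPerp Ψ u.gen := by
      refine ⟨W.sub_mem hv (W.smul_mem _ hu), ?_⟩
      rw [SetLike.mem_coe, mem_vectorPerp, map_sub, LinearMap.map_smul, LinearMap.sub_apply,
        LinearMap.smul_apply, smul_eq_mul, div_mul_cancel₀ _ u.gen_anisotropic, sub_self]
    have hne : v.gen - c • u.gen ≠ 0 := by
      intro h0
      have h0 : v.gen = c • u.gen := sub_eq_zero.1 h0
      have hc0 : c ≠ 0 := by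
        rintro hc0
        rw [hc0, zero_smul] at h0
        exact v.gen_ne_zero h0
      refine huv (NondegenerateLine.eq_of_smul_gen_eq hc0 one_ne_zero ?_)
      rw [one_smul, h0]
    obtain ⟨w, hw, hwv⟩ : ∃ w ∈ W ⊓ vectorPerp Ψ u.gen, Ψ w v.gen ≠ 0 := by
      by_contra! hcon
      refine hne (hW' _ hmem fun w hw => hΨ.eq_zero_symm ?_)
      rw [map_sub, LinearMap.map_smulₛₗ, hcon w hw, mem_vectorPerp.1 hw.2, smul_zero, sub_zero]
    have h2 := finrank_inf_vectorPerp _ hw hwv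
    rw [card_filter_mem hq (W ⊓ vectorPerp Ψ u.gen ⊓ vectorPerp Ψ v.gen)]
    · congr 1; omega
    · intro w; simp [mem_vectorPerp, and_assoc]

open Classical in
/-- The sum of the values of `f` at the lines orthogonal to `w`. -/
def perpSum (f : NondegenerateLine Ψ → ℚ) (w : V) : ℚ :=
  ∑ u : NondegenerateLine Ψ, if Ψ w u.gen = 0 then f u else 0

-- Expanding the square gives the numbers of common perpendiculars: a constant `q^(2m)` plus a
-- diagonal excess `q^(2m)(q² - 1)`. The constant part vanishes because `f` has sum zero.
omit [Finite K] in
open Classical in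
theorem sum_sq_perpSum (hΨ : IsUnitarySpace τ Ψ) {q : ℕ} (hq : Nat.card K = q ^ 2)
    {W : Submodule K V} (hW : IsNondegenerateSubspace Ψ W) {m : ℕ}
    (hd : Module.finrank K W = m + 2) (f : NondegenerateLine Ψ → ℚ)
    (hf : ∀ l, l.gen ∉ W → f l = 0) (hs : ∑ l, f l = 0) :
    ∑ w : V with w ∈ W, perpSum f w ^ 2 = ((q : ℚ) ^ 2) ^ m * ((q : ℚ) ^ 2 - 1) * ∑ l, f l ^ 2 := by
  calc ∑ w : V with w ∈ W, perpSum f w ^ 2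
      = ∑ w : V with w ∈ W, ∑ u : NondegenerateLine Ψ, ∑ v : NondegenerateLine Ψ,
          (if Ψ w u.gen = 0 ∧ Ψ w v.gen = 0 then f u * f v else 0) := by
        refine Finset.sum_congr rfl fun w _ => ?_
        rw [perpSum, sq, Finset.sum_mul_sum]
        refine Finset.sum_congr rfl fun u _ => Finset.sum_congr rfl fun v _ => ?_
        rw [ite_and]
        split_ifs <;> simp
    _ = ∑ u : NondegenerateLine Ψ, ∑ v : NondegenerateLine Ψ, f u * f v *
          (((q : ℚ) ^ 2) ^ m +
            if u = v then ((q : ℚ) ^ 2) ^ m * ((q : ℚ) ^ 2 - 1) else 0) := by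
        rw [Finset.sum_comm]
        refine Finset.sum_congr rfl fun u _ => ?_
        rw [Finset.sum_comm]
        refine Finset.sum_congr rfl fun v _ => ?_
        by_cases hu : u.gen ∈ W
        · by_cases hv : v.gen ∈ W
          · rw [← Finset.sum_filter, Finset.filter_filter, Finset.sum_const,
              card_common_perp hΨ hq hW hd hu hv, nsmul_eq_mul, mul_comm]
            congr 1
            split_ifs
            · push_cast; ring
            · push_cast; ring
          · simp [hf v hv]
        · simp [hf u hu]
    _ = _ := by
        simp only [mul_add, Finset.sum_add_distrib, mul_ite, mul_zero, Finset.sum_ite_eq,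
          Finset.mem_univ, if_true]
        have hz : ∑ u, ∑ v, f u * f v * ((q : ℚ) ^ 2) ^ m = 0 := by
          simp only [← Finset.sum_mul, ← Finset.mul_sum, hs, mul_zero, zero_mul,
            Finset.sum_const_zero]
        rw [hz, zero_add, Finset.mul_sum]
        refine Finset.sum_congr rfl fun u _ => ?_
        ring

omit [Finite K] [FiniteDimensional K V] [Fintype V] in
theorem perpSum_smul (f : NondegenerateLine Ψ → ℚ) {a : K} (ha : a ≠ 0) (w : V) :
    perpSum f (a • w) = perpSum f w := by
  have h : ∀ u, Ψ (a • w) u = 0 ↔ Ψ w u = 0 := fun u => by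
    rw [LinearMap.map_smul, LinearMap.smul_apply, smul_eq_mul, mul_eq_zero, or_iff_right ha]
  classical
  exact Finset.sum_congr rfl fun u _ => if_congr (h _) rfl rfl

-- Nonzero multiples of the generators are distinct vectors of `W`, with `q² - 1` of them on each
-- line all giving the same value. Dropping the other vectors leaves a bound on the square of the
-- adjacency operator.
open Classical in
theorem sum_sq_perpSum_gen_le (hΨ : IsUnitarySpace τ Ψ) {q : ℕ} (hq : Nat.card K = q ^ 2)
    {W : Submodule K V} (hW : IsNondegenerateSubspace Ψ W) {m : ℕ}
    (hd : Module.finrank K W = m + 2) (f : NondegenerateLine Ψ → ℚ)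
    (hf : ∀ l, l.gen ∉ W → f l = 0) (hs : ∑ l, f l = 0) :
    ∑ l : NondegenerateLine Ψ with l.gen ∈ W, perpSum f l.gen ^ 2 ≤
      ((q : ℚ) ^ 2) ^ m * ∑ l, f l ^ 2 := by
  let _ : Fintype K := Fintype.ofFinite K
  have hq1 : 1 < q ^ 2 := by rw [← hq]; exact Finite.one_lt_card
  have hq1' : (0 : ℚ) < (q : ℚ) ^ 2 - 1 := by
    rw [sub_pos]; exact_mod_cast hq1
  have hcard : (((Finset.univ : Finset K).erase 0).card : ℚ) = (q : ℚ) ^ 2 - 1 := by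
    rw [Finset.card_erase_of_mem (Finset.mem_univ _), Finset.card_univ,
      ← Nat.card_eq_fintype_card, hq, Nat.cast_sub hq1.le]
    push_cast; rfl
  refine le_of_mul_le_mul_left ?_ hq1'
  calc ((q : ℚ) ^ 2 - 1) * ∑ l : NondegenerateLine Ψ with l.gen ∈ W, perpSum f l.gen ^ 2
      = ∑ x ∈ (Finset.univ.filter fun l : NondegenerateLine Ψ => l.gen ∈ W) ×ˢ
          (Finset.univ : Finset K).erase 0, perpSum f (x.2 • x.1.gen) ^ 2 := by
        rw [Finset.sum_product, Finset.mul_sum]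
        refine Finset.sum_congr rfl fun l _ => ?_
        rw [← hcard, ← nsmul_eq_mul, ← Finset.sum_const]
        exact Finset.sum_congr rfl fun a ha => by
          rw [perpSum_smul f (Finset.ne_of_mem_erase ha)]
    _ = ∑ w ∈ ((Finset.univ.filter fun l : NondegenerateLine Ψ => l.gen ∈ W) ×ˢ
          (Finset.univ : Finset K).erase 0).image fun x => x.2 • x.1.gen, perpSum f w ^ 2 := by
        rw [Finset.sum_image]
        rintro ⟨l, a⟩ h1 ⟨l', a'⟩ h2 h
        simp only [Finset.coe_product, Set.mem_prod, Finset.mem_coe, Finset.mem_erase] at h1 h2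
        simp only at h
        obtain rfl := NondegenerateLine.eq_of_smul_gen_eq h1.2.1 h2.2.1 h
        rw [smul_left_injective K l.gen_ne_zero h]
    _ ≤ ∑ w : V with w ∈ W, perpSum f w ^ 2 := by
        refine Finset.sum_le_sum_of_subset_of_nonneg ?_ fun _ _ _ => sq_nonneg _
        intro w hw
        obtain ⟨⟨l, a⟩, hx, rfl⟩ := Finset.mem_image.1 hw
        simp only [Finset.mem_product, Finset.mem_filter, Finset.mem_univ, true_and] at hx ⊢
        exact W.smul_mem _ hx.1
    _ = ((q : ℚ) ^ 2 - 1) * (((q : ℚ) ^ 2) ^ m * ∑ l, f l ^ 2) := by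
        rw [sum_sq_perpSum hΨ hq hW hd f hf hs]; ring

open Classical in
/-- The nontrivial eigenvalues of the orthogonality graph of a non-degenerate space of dimension
`m + 2` are at most `q ^ m`. -/
theorem sum_adj_le (hΨ : IsUnitarySpace τ Ψ) {q : ℕ} (hq : Nat.card K = q ^ 2)
    {W : Submodule K V} (hW : IsNondegenerateSubspace Ψ W) {m : ℕ}
    (hd : Module.finrank K W = m + 2) (f : NondegenerateLine Ψ → ℚ)
    (hf : ∀ l, l.gen ∉ W → f l = 0) (hs : ∑ l, f l = 0) :
    ∑ w, ∑ v, (if (orthogonalityGraph Ψ).Adj w v then f v * f w else 0) ≤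
      (q : ℚ) ^ m * ∑ l, f l ^ 2 := by
  have h1 := sum_sq_perpSum_gen_le hΨ hq hW hd f hf hs
  have h2 : ∑ w, ∑ v, (if (orthogonalityGraph Ψ).Adj w v then f v * f w else 0) =
      ∑ w : NondegenerateLine Ψ with w.gen ∈ W, f w * perpSum f w.gen := by
    rw [Finset.sum_filter]
    refine Finset.sum_congr rfl fun w _ => ?_
    split_ifs with hw
    · rw [perpSum, Finset.mul_sum]
      refine Finset.sum_congr rfl fun v _ => ?_
      rw [NondegenerateLine.adj_iff hΨ, mul_ite, mul_zero, mul_comm]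
    · simp [hf w hw]
  have h3 : ∑ l, f l ^ 2 = ∑ w : NondegenerateLine Ψ with w.gen ∈ W, f w ^ 2 := by
    rw [Finset.sum_filter]
    refine Finset.sum_congr rfl fun w _ => ?_
    split_ifs with hw
    · rfl
    · simp [hf w hw]
  have hq0 : (0 : ℚ) < (q : ℚ) ^ m := by
    have : q ≠ 0 := by
      rintro rfl
      have : 0 < Nat.card K := Nat.card_pos
      rw [hq] at this; simp at this
    positivity
  -- From `A² ≤ q^(2m)` to `A ≤ q^m` without diagonalizing: `2 q^m ⟨f, A f⟩ ≤ q^(2m) ‖f‖² + ‖A f‖²`.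
  have h4 : 2 * (q : ℚ) ^ m * ∑ w : NondegenerateLine Ψ with w.gen ∈ W, f w * perpSum f w.gen ≤
      ((q : ℚ) ^ m) ^ 2 * ∑ w : NondegenerateLine Ψ with w.gen ∈ W, f w ^ 2 +
      ∑ w : NondegenerateLine Ψ with w.gen ∈ W, perpSum f w.gen ^ 2 := by
    rw [Finset.mul_sum, Finset.mul_sum, ← Finset.sum_add_distrib]
    refine Finset.sum_le_sum fun w _ => ?_
    nlinarith [sq_nonneg ((q : ℚ) ^ m * f w - perpSum f w.gen)]
  rw [h2]
  rw [← h3] at h4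
  rw [show ((q : ℚ) ^ 2) ^ m = ((q : ℚ) ^ m) ^ 2 by ring] at h1
  refine le_of_mul_le_mul_left ?_ hq0
  linarith

end Lines

/-! ### Links in the frame complex -/

section FrameLinks

variable {K : Type*} [Field K] {V : Type*} [AddCommGroup V] [Module K V] {τ : K →+* K}
  {Ψ : V →ₗ[K] V →ₛₗ[τ] K}

/-- The link of the partial frame `x` in the frame complex. -/
def frameLink (x : Finset (NondegenerateLine Ψ)) :
    PreAbstractSimplicialComplex (NondegenerateLine Ψ) where
  faces := {s | s.Nonempty ∧ (orthogonalityGraph Ψ).IsClique (s : Set _) ∧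
    ∀ v ∈ s, ∀ w ∈ x, (orthogonalityGraph Ψ).Adj v w}
  isRelLowerSet_faces := fun _ hs =>
    ⟨hs.1, fun _ hts ht => ⟨ht, hs.2.1.subset (Finset.coe_subset.2 hts),
      fun v hv => hs.2.2 v (hts hv)⟩⟩

theorem mem_frameLink {x s : Finset (NondegenerateLine Ψ)} : s ∈ frameLink x ↔
    s.Nonempty ∧ (orthogonalityGraph Ψ).IsClique (s : Set _) ∧
      ∀ v ∈ s, ∀ w ∈ x, (orthogonalityGraph Ψ).Adj v w := Iff.rfl

theorem frameLink_empty : frameLink ∅ = frameComplex Ψ := by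
  refine SetLike.ext fun s => ?_
  rw [mem_frameLink]
  constructor
  · exact fun h => ⟨h.1, h.2.1⟩
  · exact fun h => ⟨h.1, h.2, by simp⟩

theorem isClique_of_mem_frameLink {x s : Finset (NondegenerateLine Ψ)}
    (hs : s = ∅ ∨ s ∈ frameLink x) :
    (orthogonalityGraph Ψ).IsClique (s : Set _) ∧
      ∀ v ∈ s, ∀ w ∈ x, (orthogonalityGraph Ψ).Adj v w := by
  rcases hs with rfl | hs
  · simp
  · exact hs.2

theorem disjoint_of_mem_frameLink {x s : Finset (NondegenerateLine Ψ)}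
    (hs : s = ∅ ∨ s ∈ frameLink x) : Disjoint s x :=
  Finset.disjoint_left.2 fun v hv hx => (isClique_of_mem_frameLink hs).2 v hv v hx |>.ne rfl

theorem isClique_union [DecidableEq (NondegenerateLine Ψ)] {x s : Finset (NondegenerateLine Ψ)}
    (hx : (orthogonalityGraph Ψ).IsClique (x : Set _)) (hs : s = ∅ ∨ s ∈ frameLink x) :
    (orthogonalityGraph Ψ).IsClique (↑(s ∪ x) : Set (NondegenerateLine Ψ)) := by
  obtain ⟨h1, h2⟩ := isClique_of_mem_frameLink hs
  intro v hv w hw hvw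
  simp only [Finset.coe_union, Set.mem_union, Finset.mem_coe] at hv hw
  rcases hv with hv | hv <;> rcases hw with hw | hw
  · exact h1 hv hw hvw
  · exact h2 v hv w hw
  · exact (h2 w hw v hv).symm
  · exact hx hv hw hvw

/-- Turns links inside the link of `x` into subspaces `(s ∪ x)^⊥`, where the counts apply.
Anisotropy makes `v ∉ s` automatic on the right. -/
theorem insert_mem_frameLink_iff [DecidableEq (NondegenerateLine Ψ)] (hΨ : IsUnitarySpace τ Ψ)
    {x s : Finset (NondegenerateLine Ψ)} (hs : s = ∅ ∨ s ∈ frameLink x)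
    (v : NondegenerateLine Ψ) :
    (v ∉ s ∧ insert v s ∈ frameLink x) ↔ v.gen ∈ framePerp (s ∪ x) := by
  obtain ⟨h1, h2⟩ := isClique_of_mem_frameLink hs
  rw [gen_mem_framePerp_iff hΨ, mem_frameLink]
  simp only [Finset.mem_union]
  constructor
  · rintro ⟨hv, _, h3, h4⟩ w (hw | hw)
    · rw [Finset.coe_insert] at h3
      exact h3 (Set.mem_insert _ _) (Set.mem_insert_of_mem _ hw) fun h => hv (h ▸ hw)
    · exact h4 v (Finset.mem_insert_self v s) w hw
  · intro h
    have hv : v ∉ s := fun hv => (h v (Or.inl hv)).ne rfl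
    refine ⟨hv, Finset.insert_nonempty v s, ?_, ?_⟩
    · rw [Finset.coe_insert, SimpleGraph.isClique_insert_of_notMem (by simpa using hv)]
      exact ⟨h1, fun w hw => h w (Or.inl hw)⟩
    · intro w hw y hy
      rcases Finset.mem_insert.1 hw with rfl | hw
      exacts [h y (Or.inr hy), h2 w hw y hy]

theorem exists_gen_mem_framePerp [FiniteDimensional K V] (hΨ : IsUnitarySpace τ Ψ)
    {x : Finset (NondegenerateLine Ψ)} (hx : (orthogonalityGraph Ψ).IsClique (x : Set _))
    (h : x.card < Module.finrank K V) : ∃ l : NondegenerateLine Ψ, l.gen ∈ framePerp x := by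
  obtain ⟨h1, h2⟩ := framePerp_spec hΨ x hx
  obtain ⟨e, he, hee⟩ := h1.exists_anisotropic hΨ (by
    intro h0; rw [h0, finrank_bot] at h2; omega)
  exact ⟨_, NondegenerateLine.gen_mem_of_ofVector hee he⟩

theorem card_le_finrank [FiniteDimensional K V] (hΨ : IsUnitarySpace τ Ψ)
    {x : Finset (NondegenerateLine Ψ)} (hx : (orthogonalityGraph Ψ).IsClique (x : Set _)) :
    x.card ≤ Module.finrank K V := by
  have := (framePerp_spec hΨ x hx).2
  omega

theorem eq_of_gen_mem_framePerp [FiniteDimensional K V] (hΨ : IsUnitarySpace τ Ψ)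
    {x : Finset (NondegenerateLine Ψ)} (hx : (orthogonalityGraph Ψ).IsClique (x : Set _))
    (h : x.card + 1 = Module.finrank K V) {l l' : NondegenerateLine Ψ}
    (hl : l.gen ∈ framePerp x) (hl' : l'.gen ∈ framePerp x) : l = l' := by
  have h1 : Module.finrank K (framePerp x) = 1 := by
    have := (framePerp_spec hΨ x hx).2; omega
  have key : ∀ l : NondegenerateLine Ψ, l.gen ∈ framePerp x → l.1 = framePerp x := by
    intro l hl
    refine Submodule.eq_of_le_of_finrank_eq ?_ (l.2.1.trans h1.symm)
    rw [l.eq_span_gen]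
    exact (Submodule.span_singleton_le_iff_mem _ _).2 hl
  exact Subtype.ext ((key l hl).trans (key l' hl').symm)

variable [Finite K] [FiniteDimensional K V]

theorem cycles_le_boundaries_frameLink (hΨ : IsUnitarySpace τ Ψ) {q : ℕ}
    (hq : Nat.card K = q ^ 2) (hnq : Module.finrank K V < q + 1) (k : Type*) [Field k] [CharZero k]
    {x : Finset (NondegenerateLine Ψ)} (hx : (orthogonalityGraph Ψ).IsClique (x : Set _)) (i : ℤ)
    (hi : i ≤ (Module.finrank K V : ℤ) - x.card - 3) :
    simplicialCycles k (frameLink x) i ≤ simplicialBoundaries k (frameLink x) i := by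
  classical
  have : Finite V := Module.finite_of_finite K
  let _ : Fintype V := Fintype.ofFinite V
  let _ : Fintype (NondegenerateLine Ψ) := Fintype.ofFinite _
  rcases lt_trichotomy i (-1) with h | rfl | h
  · exact cycles_le_boundaries_of_lt_neg_one k _ h
  · obtain ⟨l, hl⟩ := exists_gen_mem_framePerp hΨ hx (by omega)
    refine cycles_le_boundaries_neg_one k _ (v := l) ?_
    have h1 := (insert_mem_frameLink_iff hΨ (s := ∅) (x := x) (Or.inl rfl) l).2 (by simpa using hl)
    simpa using h1.2
  · refine cycles_le_boundaries_of_rat k _ i ?_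
    obtain ⟨m, rfl⟩ : ∃ m : ℕ, i = m := ⟨i.toNat, by omega⟩
    -- Simplices of the link with `m` and `m + 1` vertices have perpendicular spaces of dimension `M
    -- + 2` and `M + 1`. The bound on `i` says `M ≥ 1`.
    obtain ⟨M, hM⟩ : ∃ M : ℕ, Module.finrank K V = x.card + m + (M + 2) :=
      ⟨Module.finrank K V - x.card - m - 2, by omega⟩
    have hM1 : 1 ≤ M := by omega
    have hdim : ∀ s, (s = ∅ ∨ s ∈ frameLink x) →
        IsNondegenerateSubspace Ψ (framePerp (s ∪ x)) ∧
        Module.finrank K (framePerp (s ∪ x)) + s.card = m + (M + 2) := by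
      intro s hs
      obtain ⟨h1, h2⟩ := framePerp_spec hΨ (s ∪ x) (isClique_union hx hs)
      rw [Finset.card_union_of_disjoint (disjoint_of_mem_frameLink hs)] at h2
      exact ⟨h1, by omega⟩
    have hq2 : (2 : ℚ) ≤ q := by
      have : 2 ≤ q := by omega
      exact_mod_cast this
    have hqq : (0 : ℚ) < (q : ℚ) ^ 2 - 1 := by nlinarith
    refine cycles_le_boundaries_of_garland (frameLink x) m ((q : ℚ) ^ M)
      (((q : ℚ) ^ 2) ^ M * ((q : ℚ) ^ 2 - q - 1) / ((q : ℚ) ^ 2 - 1)) ?_ ?_ ?_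
    · intro t ht htc f hf hs
      obtain ⟨h1, h2⟩ := hdim t ht
      refine le_trans (le_of_eq ?_) (sum_adj_le hΨ hq h1 (m := M) (by omega) f
        (fun l hl => hf l fun h => hl ((insert_mem_frameLink_iff hΨ ht l).1 h)) hs)
      refine Finset.sum_congr rfl fun w _ => Finset.sum_congr rfl fun v _ => ?_
      by_cases hw : w ∉ t ∧ insert w t ∈ frameLink x
      · by_cases hv : v ∉ t ∧ insert v t ∈ frameLink x
        · refine if_congr ?_ rfl rfl
          have h3 := insert_mem_frameLink_iff hΨ (Or.inr hw.2) v
          have h4 := (insert_mem_frameLink_iff hΨ ht v).1 hv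
          rw [gen_mem_framePerp_iff hΨ] at h4
          rw [gen_mem_framePerp_iff hΨ, Finset.insert_union] at h3
          constructor
          · rintro ⟨hvw, h5⟩
            exact (h3.1 ⟨by simp [hvw, hv.1], h5⟩ w (Finset.mem_insert_self _ _)).symm
          · intro hadj
            refine ⟨hadj.ne', (h3.2 fun l hl => ?_).2⟩
            rcases Finset.mem_insert.1 hl with rfl | hl
            exacts [hadj.symm, h4 l hl]
        · simp [hf v hv]
      · simp [hf w hw]
    · intro s hs hsc
      obtain ⟨h1, h2⟩ := hdim s (Or.inr hs)
      have h3 := le_card_lines_mul hΨ hq h1 (d := M) (by omega)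
      have h4 : (sᶜ.filter fun v => insert v s ∈ frameLink x) =
          Finset.univ.filter fun l : NondegenerateLine Ψ => l.gen ∈ framePerp (s ∪ x) := by
        ext v
        rw [Finset.mem_filter, Finset.mem_filter, Finset.mem_compl,
          insert_mem_frameLink_iff hΨ (Or.inr hs)]
        simp
      have hq1 : 1 ≤ q ^ 2 := Nat.one_le_pow _ _ (by omega)
      rw [h4, div_le_iff₀ hqq]
      have h5 : (((q ^ 2) ^ (M + 1) : ℕ) : ℚ) ≤ _ := Nat.cast_le.2 h3
      push_cast [Nat.cast_sub hq1] at h5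
      rw [pow_succ] at h5
      linarith
    · rw [lt_div_iff₀ hqq]
      -- Since `m + M + 2 ≤ n ≤ q` and `M ≥ 1`. What remains is `(q - 2)(q² - 1) < q(q² - q - 1)`,
      -- with difference `q² - 2`.
      have hm : (m : ℚ) + 1 ≤ q - 2 := by
        have : m + 1 + 2 ≤ q := by omega
        have : ((m + 1 + 2 : ℕ) : ℚ) ≤ q := Nat.cast_le.2 this
        push_cast at this
        linarith
      have hp : (q : ℚ) ≤ (q : ℚ) ^ M := le_self_pow₀ (by linarith) (by omega)
      have hp0 : (0 : ℚ) < (q : ℚ) ^ M := by linarith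
      have h1 : ((m : ℚ) + 1) * ((q : ℚ) ^ 2 - 1) < (q : ℚ) ^ M * ((q : ℚ) ^ 2 - q - 1) := by
        have h2 : ((m : ℚ) + 1) * ((q : ℚ) ^ 2 - 1) ≤ (q - 2) * ((q : ℚ) ^ 2 - 1) :=
          mul_le_mul_of_nonneg_right hm hqq.le
        have h3 : (q : ℚ) * ((q : ℚ) ^ 2 - q - 1) ≤ (q : ℚ) ^ M * ((q : ℚ) ^ 2 - q - 1) :=
          mul_le_mul_of_nonneg_right hp (by nlinarith)
        nlinarith
      have h2 := mul_lt_mul_of_pos_left h1 hp0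
      calc ((m : ℚ) + 1) * (q : ℚ) ^ M * ((q : ℚ) ^ 2 - 1)
          = (q : ℚ) ^ M * (((m : ℚ) + 1) * ((q : ℚ) ^ 2 - 1)) := by ring
        _ < _ := h2
        _ = _ := by ring

end FrameLinks

/-! ### Intervals of the reduced frame poset -/

section Intervals

variable {K : Type*} [Field K] {V : Type*} [AddCommGroup V] [Module K V] {τ : K →+* K}
  {Ψ : V →ₗ[K] V →ₛₗ[τ] K}

theorem card_chain_le {s : Finset (ReducedFramePoset Ψ)} 
    (hs : IsChain (· ≤ ·) (s : Set (ReducedFramePoset Ψ)))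
    (A : Finset ℕ) (hA : ∀ p ∈ s, p.1.card ∈ A) : s.card ≤ A.card := by
  refine Finset.card_le_card_of_injOn (fun p => p.1.card) hA fun p hp p' hp' h => ?_
  rcases hs.total hp hp' with h1 | h1
  · exact Subtype.ext (Finset.eq_of_subset_of_card_le h1 h.ge)
  · exact Subtype.ext (Finset.eq_of_subset_of_card_le h1 h.le).symm

variable [FiniteDimensional K V]

/-- The only missing size is `n - 1`; there `y^⊥` is a line, so `y` has a unique proper extension to
a partial frame. -/
theorem exists_isLeast_frame (hΨ : IsUnitarySpace τ Ψ) {y : Finset (NondegenerateLine Ψ)}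
    (hy : (orthogonalityGraph Ψ).IsClique (y : Set _)) (hne : y.Nonempty)
    (h : y.card < Module.finrank K V) :
    ∃ p : ReducedFramePoset Ψ, IsLeast {p : ReducedFramePoset Ψ | y ⊆ p.1} p := by
  classical
  by_cases hc : y.card + 1 = Module.finrank K V
  · obtain ⟨l, hl⟩ := exists_gen_mem_framePerp hΨ hy h
    have hl' := (gen_mem_framePerp_iff hΨ l y).1 hl
    have hly : l ∉ y := fun hly => (hl' l hly).ne rfl
    refine ⟨⟨insert l y, ⟨Finset.insert_nonempty l y, ?_⟩, ?_⟩, Finset.subset_insert l y, ?_⟩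
    · rw [Finset.coe_insert, SimpleGraph.isClique_insert_of_notMem (by simpa using hly)]
      exact ⟨hy, hl'⟩
    · rw [Finset.card_insert_of_notMem hly]; omega
    · intro p (hp : y ⊆ p.1)
      have hpc : p.1.card + 1 ≠ Module.finrank K V := p.2.2
      obtain ⟨l', hl'p, hl'y⟩ : ∃ l' ∈ p.1, l' ∉ y := by
        by_contra! hcon
        exact hpc (by rw [Finset.Subset.antisymm hcon hp]; exact hc)
      have : l' = l := eq_of_gen_mem_framePerp hΨ hy hc
        ((gen_mem_framePerp_iff hΨ l' y).2 fun w hw =>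
          p.2.1.2 hl'p (hp hw) fun h => hl'y (h ▸ hw)) hl
      exact Finset.insert_subset (this ▸ hl'p) hp
  · exact ⟨⟨y, ⟨hne, hy⟩, hc⟩, Finset.Subset.refl y, fun p hp => hp⟩

/-- Compare with the link of `x` through `p ↦ p \ x` and `s ↦` the least element above `s ∪ x`. -/
theorem isHomologicallySpherical_upper [Finite K] (hΨ : IsUnitarySpace τ Ψ) {q : ℕ}
    (hq : Nat.card K = q ^ 2) (hnq : Module.finrank K V < q + 1) (k : Type*) [Field k] [CharZero k]
    {x : Finset (NondegenerateLine Ψ)} (hx : (orthogonalityGraph Ψ).IsClique (x : Set _))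
    (hxc : x.card + 1 ≠ Module.finrank K V) :
    IsHomologicallySpherical k (orderComplex {p : ReducedFramePoset Ψ | x ⊂ p.1}) := by
  classical
  rintro i ⟨c, hc, hic⟩
  rw [subsingleton_reducedHomology_iff]
  rcases hc with rfl | hc
  · exact cycles_le_boundaries_of_lt_neg_one k _ (by simpa using hic)
  obtain ⟨⟨p₀, hp₀⟩, hcS, hchain⟩ := hc
  have hn : ∀ p : ReducedFramePoset Ψ, p.1.card ≤ Module.finrank K V := fun p =>
    card_le_finrank hΨ p.2.1.2
  have hxn : x.card + 2 ≤ Module.finrank K V := by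
    have h1 := Finset.card_lt_card (hcS p₀ hp₀)
    have h2 := hn p₀
    omega
  -- Sizes range over `|x| + 1, …, n` without `n - 1`. The lost size lowers the dimension by one and
  -- yields exactly the degrees `i ≤ n - |x| - 3` treated for links.
  have hcc : c.card ≤ Module.finrank K V - x.card - 1 := by
    refine (card_chain_le hchain ((Finset.Ioc x.card (Module.finrank K V)).erase
      (Module.finrank K V - 1)) fun p hp => ?_).trans (le_of_eq ?_)
    · have h1 := Finset.card_lt_card (hcS p hp)
      have h2 := p.2.2
      rw [Finset.mem_erase, Finset.mem_Ioc]
      exact ⟨by omega, h1, hn p⟩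
    · rw [Finset.card_erase_of_mem (Finset.mem_Ioc.2 ⟨by omega, by omega⟩), Nat.card_Ioc]
  have hlt : ∀ s ∈ frameLink x, (s.card : ℤ) ≤ i + 2 → (s ∪ x).card < Module.finrank K V := by
    intro s hs hsc
    rw [Finset.card_union_of_disjoint (disjoint_of_mem_frameLink (Or.inr hs))]
    omega
  have hleast : ∀ s : Finset (NondegenerateLine Ψ), ∃ p : ReducedFramePoset Ψ,
      s ∈ frameLink x → (s.card : ℤ) ≤ i + 2 →
        IsLeast {p : ReducedFramePoset Ψ | s ∪ x ⊆ p.1} p := by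
    intro s
    by_cases h : s ∈ frameLink x ∧ (s.card : ℤ) ≤ i + 2
    · obtain ⟨p, hp⟩ := exists_isLeast_frame hΨ (isClique_union hx (Or.inr h.1))
        (h.1.1.mono Finset.subset_union_left) (hlt s h.1 h.2)
      exact ⟨p, fun _ _ => hp⟩
    · exact ⟨p₀, fun h1 h2 => absurd ⟨h1, h2⟩ h⟩
  choose t ht using hleast
  obtain ⟨l₀, _⟩ := p₀.2.1.1
  have : Nonempty (NondegenerateLine Ψ) := ⟨l₀⟩
  refine cycles_le_boundaries_orderComplex k (frameLink x) _ (fun p => p.1 \ x) t i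
    ?_ ?_ ?_ ?_ ?_ (cycles_le_boundaries_frameLink hΨ hq hnq k hx i (by omega))
  · intro p (hp : x ⊂ p.1)
    refine ⟨Finset.sdiff_nonempty.2 hp.2, p.2.1.2.subset (by simp), ?_⟩
    intro v hv w hw
    rw [Finset.mem_sdiff] at hv
    exact p.2.1.2 hv.1 (hp.1 hw) fun h => hv.2 (h ▸ hw)
  · exact fun p _ p' _ h => Finset.sdiff_subset_sdiff h (Finset.Subset.refl x)
  · intro s hs hsc
    have h1 : s ∪ x ⊆ (t s).1 := (ht s hs hsc).1
    refine ⟨Finset.subset_union_right.trans h1, fun h2 => ?_⟩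
    obtain ⟨v, hv⟩ := hs.1
    exact Finset.disjoint_left.1 (disjoint_of_mem_frameLink (Or.inr hs)) hv
      (h2 (h1 (Finset.mem_union_left _ hv)))
  · intro s hs s' hs' hsc hss
    have h1 : s' ∪ x ⊆ (t s').1 := (ht s' hs' hsc).1
    have h2 : (s.card : ℤ) ≤ s'.card := by exact_mod_cast Finset.card_le_card hss
    exact (ht s hs (h2.trans hsc)).2 ((Finset.union_subset_union_left hss).trans h1)
  · intro s hs hsc p (hp : x ⊂ p.1) hsp
    exact (ht s hs hsc).2 (Finset.union_subset (hsp.trans Finset.sdiff_subset) hp.1)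

/-- The complex of all nonempty subsets of `y`. -/
def fullSimplex {α : Type*} (y : Finset α) : PreAbstractSimplicialComplex α where
  faces := {s | s.Nonempty ∧ s ⊆ y}
  isRelLowerSet_faces := fun _ hs => ⟨hs.1, fun _ hts ht => ⟨ht, hts.trans hs.2⟩⟩

/-- Compare with the full simplex on `y \ x`, which is a cone. Only its faces with at most `i + 2`
vertices must give elements `s ∪ x` of the interval. -/
theorem isHomologicallySpherical_bounded (hΨ : IsUnitarySpace τ Ψ) (k : Type*) [Field k]
    {x : Finset (NondegenerateLine Ψ)} (hxc : x.card + 1 ≠ Module.finrank K V)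
    (y : ReducedFramePoset Ψ) :
    IsHomologicallySpherical k
      (orderComplex {p : ReducedFramePoset Ψ | x ⊂ p.1 ∧ p.1 ⊂ y.1}) := by
  classical
  rintro i ⟨c, hc, hic⟩
  rw [subsingleton_reducedHomology_iff]
  rcases hc with rfl | hc
  · exact cycles_le_boundaries_of_lt_neg_one k _ (by simpa using hic)
  obtain ⟨⟨p₀, hp₀⟩, hcS, hchain⟩ := hc
  have hxy : x ⊂ y.1 := (hcS p₀ hp₀).1.trans (hcS p₀ hp₀).2
  have hyn : y.1.card ≤ Module.finrank K V := card_le_finrank hΨ y.2.1.2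
  have hyc : y.1.card + 1 ≠ Module.finrank K V := y.2.2
  have hxyc := Finset.card_lt_card hxy
  -- When `|y| = n` the size `n - 1` is also unavailable, which costs one more. With `i + 2 ≤ |c|`
  -- this keeps `s ∪ x` strictly below `y` and away from the missing size.
  have hcc : x.card + c.card + 1 ≤ y.1.card ∧
      (y.1.card = Module.finrank K V → x.card + c.card + 2 ≤ y.1.card) := by
    have h1 := card_chain_le hchain (Finset.Ioo x.card y.1.card) fun p hp =>
      Finset.mem_Ioo.2 ⟨Finset.card_lt_card (hcS p hp).1, Finset.card_lt_card (hcS p hp).2⟩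
    rw [Nat.card_Ioo] at h1
    refine ⟨by omega, fun hy => ?_⟩
    have h2 := card_chain_le hchain ((Finset.Ioo x.card y.1.card).erase (y.1.card - 1))
      fun p hp => by
        have h1 := Finset.card_lt_card (hcS p hp).1
        have h2 := Finset.card_lt_card (hcS p hp).2
        have h3 := p.2.2
        rw [Finset.mem_erase, Finset.mem_Ioo]
        exact ⟨by omega, h1, h2⟩
    rw [Finset.card_erase_of_mem (Finset.mem_Ioo.2 ⟨by omega, by omega⟩), Nat.card_Ioo] at h2
    omega
  have hface : ∀ s ∈ fullSimplex (y.1 \ x), (s.card : ℤ) ≤ i + 2 →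
      ((s ∪ x) ∈ frameComplex Ψ ∧ (s ∪ x).card + 1 ≠ Module.finrank K V) ∧
        (s ∪ x).card < y.1.card ∧ s ∪ x ⊆ y.1 := by
    intro s hs hsc
    have hsub : s ∪ x ⊆ y.1 := Finset.union_subset (hs.2.trans Finset.sdiff_subset) hxy.1
    have hcard : (s ∪ x).card = s.card + x.card :=
      Finset.card_union_of_disjoint (Finset.disjoint_of_subset_left hs.2 Finset.sdiff_disjoint)
    refine ⟨⟨⟨hs.1.mono Finset.subset_union_left, y.2.1.2.subset (Finset.coe_subset.2 hsub)⟩, ?_⟩,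
      ?_, hsub⟩
    · by_cases hy : y.1.card = Module.finrank K V
      · have := hcc.2 hy; omega
      · omega
    · omega
  let t : Finset (NondegenerateLine Ψ) → ReducedFramePoset Ψ := fun s =>
    if h : (s ∪ x) ∈ frameComplex Ψ ∧ (s ∪ x).card + 1 ≠ Module.finrank K V then ⟨s ∪ x, h⟩ else y
  have ht : ∀ s ∈ fullSimplex (y.1 \ x), (s.card : ℤ) ≤ i + 2 → (t s).1 = s ∪ x := by
    intro s hs hsc
    simp only [t, dif_pos (hface s hs hsc).1]
  obtain ⟨l₀, hl₀, hl₀x⟩ := Finset.exists_of_ssubset hxy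
  have : Nonempty (NondegenerateLine Ψ) := ⟨l₀⟩
  refine cycles_le_boundaries_orderComplex k (fullSimplex (y.1 \ x)) _ (fun p => p.1 \ x) t i
    ?_ ?_ ?_ ?_ ?_ (cycles_le_boundaries_of_cone k _ l₀ ?_ i)
  · rintro p ⟨hp, hp'⟩
    exact ⟨Finset.sdiff_nonempty.2 hp.2, Finset.sdiff_subset_sdiff hp'.1 (Finset.Subset.refl x)⟩
  · exact fun p _ p' _ h => Finset.sdiff_subset_sdiff h (Finset.Subset.refl x)
  · intro s hs hsc
    have h1 := ht s hs hsc
    obtain ⟨_, h2, h3⟩ := hface s hs hsc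
    simp only [Set.mem_ofPred_eq, h1]
    refine ⟨⟨Finset.subset_union_right, fun h4 => ?_⟩, h3, fun h4 => ?_⟩
    · obtain ⟨v, hv⟩ := hs.1
      exact (Finset.mem_sdiff.1 (hs.2 hv)).2 (h4 (Finset.mem_union_left _ hv))
    · exact absurd (Finset.card_le_card h4) (not_le.2 h2)
  · intro s hs s' hs' hsc hss
    have h2 : (s.card : ℤ) ≤ s'.card := by exact_mod_cast Finset.card_le_card hss
    change (t s).1 ⊆ (t s').1
    rw [ht s hs (h2.trans hsc), ht s' hs' hsc]
    exact Finset.union_subset_union_left hss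
  · rintro s hs hsc p ⟨hp, _⟩ hsp
    change (t s).1 ⊆ p.1
    rw [ht s hs hsc]
    exact Finset.union_subset (hsp.trans Finset.sdiff_subset) hp.1
  · intro s hs
    refine ⟨Finset.insert_nonempty l₀ s, Finset.insert_subset (Finset.mem_sdiff.2 ⟨hl₀, hl₀x⟩) ?_⟩
    rcases hs with rfl | hs
    exacts [Finset.empty_subset _, hs.2]

end Intervals
end

/-! ### The main theorem -/

theorem theorem1p4 {K : Type*} [Field K] [Finite K] (q : ℕ) (hq : Nat.card K = q ^ 2)
    {V : Type*} [AddCommGroup V] [Module K V] [FiniteDimensional K V]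
    (τ : K →+* K) (Ψ : V →ₗ[K] V →ₛₗ[τ] K) (hΨ : IsUnitarySpace τ Ψ)
    (n : ℕ) (hn : Module.finrank K V = n) (hn2 : 2 ≤ n) (hnq : n < q + 1)
    (k : Type*) [Field k] [CharZero k] :
    (∀ i : ℤ, 0 ≤ i → i ≤ (n : ℤ) - 3 → Subsingleton (reducedHomology k (frameComplex Ψ) i)) ∧
      IsHomologicallyCohenMacaulay k (ReducedFramePoset Ψ) := by
  subst hn
  constructor
  · intro i _ hi
    rw [subsingleton_reducedHomology_iff, ← frameLink_empty]
    exact cycles_le_boundaries_frameLink hΨ hq hnq k (by simp) i (by simpa using hi)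
  -- The adjoined least element behaves like the empty frame, whose size differs from `n - 1`
  -- because `n ≥ 2`.
  · have hbot : ∀ p : ReducedFramePoset Ψ, ∅ ⊂ p.1 := fun p => Finset.empty_ssubset.2 p.2.1.1
    have hlt : ∀ p p' : ReducedFramePoset Ψ, p < p' ↔ p.1 ⊂ p'.1 := fun _ _ => Iff.rfl
    intro x y hxy
    induction x using WithBot.recBotCoe with
    | bot =>
      induction y using WithBot.recBotCoe with
      | bot => exact absurd hxy (lt_irrefl _)
      | coe y =>
        induction y using WithTop.recTopCoe with
        | top =>
          convert isHomologicallySpherical_upper hΨ hq hnq k (x := ∅) (by simp)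
            (by simp; omega) using 2
          ext p
          simp only [openInterval, Set.mem_ofPred_eq, WithBot.bot_lt_coe, WithBot.coe_lt_coe,
            WithTop.coe_lt_top, hbot p, and_self]
        | coe y =>
          convert isHomologicallySpherical_bounded hΨ k (x := ∅) (by simp; omega) y using 2
          ext p
          simp only [openInterval, Set.mem_ofPred_eq, WithBot.bot_lt_coe, WithBot.coe_lt_coe,
            WithTop.coe_lt_coe, hbot p, hlt]
    | coe x =>
      induction x using WithTop.recTopCoe with
      | top => exact absurd hxy (by simp)
      | coe x =>
        induction y using WithBot.recBotCoe with
        | bot => exact absurd hxy (by simp)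
        | coe y =>
          induction y using WithTop.recTopCoe with
          | top =>
            convert isHomologicallySpherical_upper hΨ hq hnq k x.2.1.2 x.2.2 using 2
            ext p
            simp only [openInterval, Set.mem_ofPred_eq, WithBot.coe_lt_coe, WithTop.coe_lt_coe,
              WithTop.coe_lt_top, and_true, hlt]
          | coe y =>
            convert isHomologicallySpherical_bounded hΨ k x.2.2 y using 2
            ext p
            simp only [openInterval, Set.mem_ofPred_eq, WithBot.coe_lt_coe, WithTop.coe_lt_coe,
              hlt]
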